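/- There are $n$ players and a secret $X$; let $L_i\in\{0,1\}$ indicate whether player $i$ is a leaker (knows $X$). A (collaborating) protocol $\pi$ specifies, for every possible tuple $t^k$ of messages broadcast so far, whether to stop and, if not, which player $i$ sends the next message, a discrete distribution $p_?$ and discrete distributions $(p_x)_{x}$, one for each value $x$ of $X$; the message is drawn from $p_?$ if $L_i=0$, and from $p_x$ if $L_i=1$ and $X=x$. The number of messages must be bounded by a number depending only on $\pi$. Let $T$ denote the complete transcript. For real $h$ and a distribution of $L=(L_1,\dots,L_n)$, let $X$ be uniform on $\mathcal X=\{1,\dots,2^{\lceil h\rceil}\}$ and independent of $L$ (if $h<0$, read $2^{\lceil h\rceil}$ as $1$). A risky $(n,h,L,c,\epsilon)$-protocol is a protocol together with a function $D$ from transcripts to $\mathcal X$ such that for every $x\in\mathcal X$, with probability at least $1-\epsilon$ a random transcript $t$ distributed as $T|_{X=x}$ satisfies both $\Pr(L_i=1\mid T=t,X=x)\le c$ for all $i$, and $D(t)=x$. It is safe if moreover $\Pr(L_i=1\mid T=t,X=x)\le c$ for all $i,t,x$ with $\Pr(T=t,X=x)>0$. For $l\le n$ let $\mathrm{Fixed}(l,n)$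 be the distribution of $(L_1,\dots,L_n)$ for which the set $\{i: L_i=1\}$ is uniformly distributed over all $l$-element subsets of $\{1,\dots,n\}$. A rate $R\in\mathbb R$ is safely (respectively riskily) $c$-achievable for $\mathrm{Fixed}$ if for all $\epsilon>0$ and all $l_0\in\mathbb N$ there are $l\ge l_0$ and $n\ge l$ for which a safe (respectively risky) $(n,lR,\mathrm{Fixed}(l,n),c,\epsilon)$-protocol exists. The safe (respectively risky) $c$-capacity for $\mathrm{Fixed}$ is the supremum of all safely (respectively riskily) $c$-achievable rates. Theorem. Let $c\in(0,1)$. The safe $c$-capacity for $\mathrm{Fixed}$ and the risky $c$-capacity for $\mathrm{Fixed}$ are both equal to $$\frac{-\log_2(1-c)}{c}-\log_2(e).$$ -/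

import Mathlib

namespace Cryptogenography

/-- Probability of an event under a discrete distribution. -/
noncomputable def prob {Ω : Type*} (p : PMF Ω) (E : Set Ω) : ℝ :=
  (p.toOuterMeasure E).toReal

/-- Conditional probability `Pr(E | F)`; only meaningful when `Pr(F) > 0`. -/
noncomputable def condProb {Ω : Type*} (p : PMF Ω) (E F : Set Ω) : ℝ :=
  prob p (E ∩ F) / prob p F

/-- A collaborating cryptogenography protocol for `n` players and a secret with values in `𝒳`.
Messages are (codes of) elements of a countable set, so that every discrete distribution of a
message is allowed, and a (partial) transcript is the list of the messages sent so far. -/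
structure Protocol (n : ℕ) (𝒳 : Type*) where
  /-- `none`: the communication stops; `some i`: player `i` sends the next message. -/
  next : List ℕ → Option (Fin n)
  /-- The distribution `p_?` of the next message if its sender is not a leaker. -/
  ignorant : List ℕ → PMF ℕ
  /-- The distributions `p_x` of the next message if its sender is a leaker and `X = x`. -/
  leaking : List ℕ → 𝒳 → PMF ℕ
  /-- A bound for the number of messages. -/
  length : ℕ
  terminates : ∀ t : List ℕ, length ≤ t.length → next t = none

namespace Protocol

variable {n : ℕ} {𝒳 : Type*}

/-- The distribution of the transcript after at most `k` further messages, when the current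
transcript is `t`, the secret is `x`, and player `i` is a leaker iff `ℓ i = true`. -/
noncomputable def run (π : Protocol n 𝒳) (x : 𝒳) (ℓ : Fin n → Bool) :
    ℕ → List ℕ → PMF (List ℕ)
  | 0, t => PMF.pure t
  | k + 1, t =>
    match π.next t with
    | none => PMF.pure t
    | some i =>
      (if ℓ i = true then π.leaking t x else π.ignorant t).bind
        fun m => run π x ℓ k (t ++ [m])

/-- The joint distribution of `(X, (L₁, …, Lₙ), T)`, where `X` is uniform on `𝒳`, the tuple
`(L₁, …, Lₙ)` has distribution `L` and is independent of `X`, and `T` is the complete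
transcript. -/
noncomputable def joint [Fintype 𝒳] [Nonempty 𝒳] (π : Protocol n 𝒳) (L : PMF (Fin n → Bool)) :
    PMF (𝒳 × (Fin n → Bool) × List ℕ) :=
  (PMF.uniformOfFintype 𝒳).bind fun x =>
    L.bind fun ℓ =>
      (π.run x ℓ π.length []).map fun t => (x, ℓ, t)

/-- `Pr(Lᵢ = 1 | T = t, X = x)`. -/
noncomputable def posterior [Fintype 𝒳] [Nonempty 𝒳] (π : Protocol n 𝒳)
    (L : PMF (Fin n → Bool)) (i : Fin n) (t : List ℕ) (x : 𝒳) : ℝ :=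
  condProb (π.joint L) {ω | ω.2.1 i = true} {ω | ω.2.2 = t ∧ ω.1 = x}

/-- With decoding function `D`: for every `x`, conditionally on `X = x`, with probability at
least `1 - ε` the transcript `T` satisfies `Pr(Lᵢ = 1 | T = t, X = x) ≤ c` for all `i`, and
`D T = x`. -/
def IsRisky [Fintype 𝒳] [Nonempty 𝒳] (π : Protocol n 𝒳) (D : List ℕ → 𝒳)
    (L : PMF (Fin n → Bool)) (c ε : ℝ) : Prop :=
  ∀ x : 𝒳, 1 - ε ≤
    condProb (π.joint L)
      {ω | (∀ i, π.posterior L i ω.2.2 x ≤ c) ∧ D ω.2.2 = x} {ω | ω.1 = x}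

/-- A risky protocol in which the posterior never exceeds `c`. -/
def IsSafe [Fintype 𝒳] [Nonempty 𝒳] (π : Protocol n 𝒳) (D : List ℕ → 𝒳)
    (L : PMF (Fin n → Bool)) (c ε : ℝ) : Prop :=
  π.IsRisky D L c ε ∧
    ∀ (i : Fin n) (t : List ℕ) (x : 𝒳),
      0 < prob (π.joint L) {ω | ω.2.2 = t ∧ ω.1 = x} → π.posterior L i t x ≤ c

end Protocol

/-- There is a risky `(n, h, L, c, ε)`-protocol; the secret takes `2 ^ ⌈h⌉` values. -/
def ExistsRisky (n : ℕ) (h : ℝ) (L : PMF (Fin n → Bool)) (c ε : ℝ) : Prop :=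
  ∃ (π : Protocol n (Fin (2 ^ ⌈h⌉₊))) (D : List ℕ → Fin (2 ^ ⌈h⌉₊)), π.IsRisky D L c ε

/-- There is a safe `(n, h, L, c, ε)`-protocol; the secret takes `2 ^ ⌈h⌉` values. -/
def ExistsSafe (n : ℕ) (h : ℝ) (L : PMF (Fin n → Bool)) (c ε : ℝ) : Prop :=
  ∃ (π : Protocol n (Fin (2 ^ ⌈h⌉₊))) (D : List ℕ → Fin (2 ^ ⌈h⌉₊)), π.IsSafe D L c ε

/-- The distribution `Fixed(l, n)`: the set of leakers is uniformly distributed over all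
`l`-element subsets of the `n` players. -/
noncomputable def fixed (l n : ℕ) (hln : l ≤ n) : PMF (Fin n → Bool) :=
  (PMF.uniformOfFinset (Finset.powersetCard l (Finset.univ : Finset (Fin n)))
    (Finset.powersetCard_nonempty.mpr (by simpa using hln))).map fun S i => decide (i ∈ S)

/-- The rate `R` is riskily `c`-achievable for `Fixed`. -/
def RiskilyAchievable (c R : ℝ) : Prop :=
  ∀ ε : ℝ, 0 < ε → ∀ l₀ : ℕ, ∃ l : ℕ, l₀ ≤ l ∧ ∃ (n : ℕ) (hln : l ≤ n),
    ExistsRisky n (l * R) (fixed l n hln) c ε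

/-- The rate `R` is safely `c`-achievable for `Fixed`. -/
def SafelyAchievable (c R : ℝ) : Prop :=
  ∀ ε : ℝ, 0 < ε → ∀ l₀ : ℕ, ∃ l : ℕ, l₀ ≤ l ∧ ∃ (n : ℕ) (hln : l ≤ n),
    ExistsSafe n (l * R) (fixed l n hln) c ε

/-- `C` is the risky `c`-capacity for `Fixed`: the supremum of the riskily achievable rates. -/
def IsRiskyCapacity (c C : ℝ) : Prop := IsLUB {R : ℝ | RiskilyAchievable c R} C

/-- `C` is the safe `c`-capacity for `Fixed`: the supremum of the safely achievable rates. -/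
def IsSafeCapacity (c C : ℝ) : Prop := IsLUB {R : ℝ | SafelyAchievable c R} C

end Cryptogenography

/-! Write g = -log(1-c)/c. In natural logarithms the capacity is g - 1.

Converse. Each message depends on the leaker status of its sender only, so the likelihood of a
transcript is q * ∏ i ∈ S, z i, where S is the set of leakers and q is its probability with no
leakers, which does not depend on the secret. The posteriors are then the marginals of a random
l-set with weights z. With w = l/(n-l) * z, compare f = `weightSum l w`, the likelihood ratio
against q up to normalization, with W = ∏ i, (1 + w i), the same quantity when players leak
independently. If all marginals are at most c, then (1+η) log f ≤ log W + ηl(g + η/(1-c))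
(`log_weightSum_le`, from Jensen and a tilt of each player). Transcripts with W much larger than f
carry little mass. On the others f is at most e^(lg + o(l)), and normalization divides by about e^l,
so a good transcript is at most e^(l(g-1) + o(l)) times likelier than under q (`law_mixture_le`).
The decoding events of different secrets are disjoint under q, which bounds the number of secrets
(`card_secrets_le`).

Achievability. Each message excludes a random small part of the secrets; a leaker never excludes the
true one. After ρ rounds an ignorant player survives for a given secret with small probability a,
and n is chosen so that n * a slightly exceeds l(1-c)/c. The true secret then has about l/c
survivors, all nearly equally suspicious. A wrong secret has about l(1-c)/c, and by Chernoff it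
reaches l/c with probability about e^(-l(g-1)), so a union bound over 2^(lR) secrets succeeds
(`isSafe`). Leakers stop leaking when survivors become too few, which makes the protocol safe. -/

namespace Cryptogenography

open Finset

/-! ### Real-valued probabilities of discrete distributions. -/

section PMF

variable {Ω : Type*}

theorem toOuterMeasure_ne_top (p : PMF Ω) (E : Set Ω) : p.toOuterMeasure E ≠ ⊤ := by
  refine ne_top_of_le_ne_top ENNReal.one_ne_top ?_
  rw [← (p.toOuterMeasure_apply_eq_one_iff Set.univ).mpr (Set.subset_univ _)]
  exact p.toOuterMeasure.mono (Set.subset_univ _)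

theorem hasSum_prob (p : PMF Ω) (E : Set Ω) :
    HasSum (E.indicator fun t => (p t).toReal) (prob p E) := by
  have h : (∑' t, E.indicator p t) ≠ ⊤ := by
    rw [← PMF.toOuterMeasure_apply]
    exact toOuterMeasure_ne_top p E
  have := (ENNReal.summable_toReal h).hasSum
  rw [← ENNReal.tsum_toReal_eq (fun t => ENNReal.ne_top_of_tsum_ne_top h t),
    ← PMF.toOuterMeasure_apply] at this
  convert this using 1
  · funext t
    by_cases ht : t ∈ E <;> simp [ht]
  · rfl

theorem prob_nonneg (p : PMF Ω) (E : Set Ω) : 0 ≤ prob p E := ENNReal.toReal_nonneg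

theorem prob_singleton (p : PMF Ω) (t : Ω) : prob p {t} = (p t).toReal := by
  simp [prob, PMF.toOuterMeasure_apply_singleton]

theorem prob_univ (p : PMF Ω) : prob p Set.univ = 1 := by
  rw [prob, (p.toOuterMeasure_apply_eq_one_iff _).mpr (Set.subset_univ _)]; rfl

theorem prob_mono_of_support (p : PMF Ω) {E F : Set Ω} (h : ∀ t, p t ≠ 0 → t ∈ E → t ∈ F) :
    prob p E ≤ prob p F := by
  refine hasSum_le (fun t => ?_) (hasSum_prob p E) (hasSum_prob p F)
  by_cases hp : p t = 0
  · simp [Set.indicator, hp]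
  · by_cases hE : t ∈ E
    · simp [hE, h t hp hE]
    · simp only [hE, not_false_eq_true, Set.indicator_of_notMem]
      exact Set.indicator_nonneg (fun _ _ => ENNReal.toReal_nonneg) _

theorem prob_le_one (p : PMF Ω) (E : Set Ω) : prob p E ≤ 1 :=
  prob_univ p ▸ prob_mono_of_support p (fun _ _ _ => Set.mem_univ _)

theorem prob_union_le (p : PMF Ω) (E F : Set Ω) : prob p (E ∪ F) ≤ prob p E + prob p F := by
  refine hasSum_le (fun t => ?_) (hasSum_prob p _) ((hasSum_prob p E).add (hasSum_prob p F))
  have : 0 ≤ (p t).toReal := ENNReal.toReal_nonneg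
  by_cases hE : t ∈ E <;> by_cases hF : t ∈ F <;> simp [hE, hF]

theorem prob_compl (p : PMF Ω) (E : Set Ω) : prob p Eᶜ = 1 - prob p E := by
  have h := (hasSum_prob p E).add (hasSum_prob p Eᶜ)
  have h1 := hasSum_prob p Set.univ
  rw [prob_univ] at h1
  have : (fun t => E.indicator (fun t => (p t).toReal) t + Eᶜ.indicator (fun t => (p t).toReal) t)
      = Set.univ.indicator fun t => (p t).toReal := by
    funext t
    by_cases hE : t ∈ E <;> simp [hE]
  rw [this] at h
  linarith [h.unique h1]

theorem prob_biUnion_le {ι : Type*} (p : PMF Ω) (s : Finset ι) (E : ι → Set Ω) :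
    prob p (⋃ i ∈ s, E i) ≤ ∑ i ∈ s, prob p (E i) := by
  classical
  induction s using Finset.induction_on with
  | empty => simp [prob]
  | insert a s ha ih =>
    rw [Finset.set_biUnion_insert, Finset.sum_insert ha]
    exact (prob_union_le _ _ _).trans (by linarith)

/-- The events lie in distinct fibers of `D`, hence are disjoint. This is the counting step of the
converse. -/
theorem sum_prob_le_one_of_fibers {𝒳 : Type*} [Fintype 𝒳] (p : PMF Ω) (D : Ω → 𝒳)
    (E : 𝒳 → Set Ω) (hE : ∀ x, ∀ t ∈ E x, D t = x) : ∑ x, prob p (E x) ≤ 1 := by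
  classical
  rw [← prob_univ p]
  refine hasSum_le (fun t => ?_) (hasSum_sum fun x _ => hasSum_prob p (E x)) (hasSum_prob p _)
  rw [Finset.sum_eq_single_of_mem (D t) (mem_univ _)]
  · exact Set.indicator_le_indicator_of_subset (Set.subset_univ _)
      (fun _ => ENNReal.toReal_nonneg) t
  · intro x _ hx
    exact Set.indicator_of_notMem (fun h => hx (hE x t h).symm) _

end PMF

/-! ### Transcript laws, likelihoods and posteriors. -/

namespace Protocol

variable {n : ℕ} {𝒳 : Type*}

/-- The law of the complete transcript when the secret is `x` and `S` is the set of leakers. -/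
noncomputable def law (π : Protocol n 𝒳) (x : 𝒳) (S : Finset (Fin n)) : PMF (List ℕ) :=
  π.run x (fun i => decide (i ∈ S)) π.length []

/-- The probability of the message `m` after the partial transcript `t`. -/
noncomputable def messageProb (π : Protocol n 𝒳) (x : 𝒳) (ℓ : Fin n → Bool) (t : List ℕ) (m : ℕ) :
    ℝ :=
  match π.next t with
  | none => 1
  | some i => ((if ℓ i = true then π.leaking t x else π.ignorant t) m).toReal

/-- The likelihood of the messages `s` after the partial transcript `t`. -/
noncomputable def likelihood (π : Protocol n 𝒳) (x : 𝒳) (ℓ : Fin n → Bool) :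
    List ℕ → List ℕ → ℝ
  | _, [] => 1
  | t, m :: s => π.messageProb x ℓ t m * π.likelihood x ℓ (t ++ [m]) s

theorem likelihood_concat (π : Protocol n 𝒳) (x : 𝒳) (ℓ : Fin n → Bool) (t s : List ℕ) (m : ℕ) :
    π.likelihood x ℓ t (s ++ [m]) = π.likelihood x ℓ t s * π.messageProb x ℓ (t ++ s) m := by
  induction s generalizing t with
  | nil => simp [likelihood]
  | cons a s ih => simp [likelihood, ih, mul_assoc]

theorem exists_append_of_run_ne_zero (π : Protocol n 𝒳) (x : 𝒳) (ℓ : Fin n → Bool) (k : ℕ)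
    (t₀ t : List ℕ) (h : π.run x ℓ k t₀ t ≠ 0) : ∃ s, t = t₀ ++ s ∧ s.length ≤ k := by
  induction k generalizing t₀ with
  | zero =>
    simp only [run, PMF.pure_apply, ne_eq, ite_eq_right_iff, one_ne_zero, imp_false,
      not_not] at h
    exact ⟨[], by simp [h]⟩
  | succ k ih =>
    rw [run] at h
    split at h
    · simp only [PMF.pure_apply, ne_eq, ite_eq_right_iff, one_ne_zero, imp_false,
        not_not] at h
      exact ⟨[], by simp [h]⟩
    · rw [← PMF.mem_support_iff, PMF.mem_support_bind_iff] at h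
      obtain ⟨m, -, hm⟩ := h
      obtain ⟨s, hs, hk⟩ := ih _ ((PMF.mem_support_iff _ _).mp hm)
      exact ⟨m :: s, by simp [hs], by simpa using hk⟩

/-- Whether the run may end at `t ++ s` is decided by `next` and `k`, not by the secret or the
leakers; hence the quantifiers over `x` and `ℓ` stand inside the disjunction. -/
theorem run_eq_likelihood_or_zero (π : Protocol n 𝒳) (k : ℕ) (t s : List ℕ) :
    (∀ x ℓ, (π.run x ℓ k t (t ++ s)).toReal = π.likelihood x ℓ t s) ∨
      ∀ x ℓ, (π.run x ℓ k t (t ++ s)).toReal = 0 := by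
  induction k generalizing t s with
  | zero =>
    cases s with
    | nil => left; intro x ℓ; simp [run, likelihood]
    | cons a s => right; intro x ℓ; simp [run]
  | succ k ih =>
    rcases hn : π.next t with _ | i
    · cases s with
      | nil => left; intro x ℓ; simp [run, likelihood, hn]
      | cons a s => right; intro x ℓ; simp [run, hn]
    · cases s with
      | nil =>
        right; intro x ℓ
        rw [run, hn]
        simp only [List.append_nil, PMF.bind_apply]
        rw [ENNReal.tsum_eq_zero.mpr]
        · rfl
        intro m
        by_contra h
        obtain ⟨s, hs, -⟩ := exists_append_of_run_ne_zero π x ℓ k _ _ (right_ne_zero_of_mul h)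
        simp at hs
      | cons a s =>
        have key : ∀ x ℓ, (π.run x ℓ (k + 1) t (t ++ a :: s)).toReal =
            π.messageProb x ℓ t a * (π.run x ℓ k (t ++ [a]) ((t ++ [a]) ++ s)).toReal := by
          intro x ℓ
          rw [run, messageProb, hn]
          simp only [PMF.bind_apply]
          rw [tsum_eq_single a, ENNReal.toReal_mul]
          · simp
          · intro m hm
            by_contra h
            obtain ⟨s', hs, -⟩ := exists_append_of_run_ne_zero π x ℓ k _ _ (right_ne_zero_of_mul h)
            simp only [List.append_assoc, List.append_cancel_left_eq, List.cons_append,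
              List.nil_append, List.cons.injEq] at hs
            exact hm hs.1.symm
        rcases ih (t ++ [a]) s with h | h
        · left; intro x ℓ; rw [key, h, likelihood]
        · right; intro x ℓ; rw [key, h, mul_zero]

theorem law_eq_likelihood_or_zero (π : Protocol n 𝒳) (t : List ℕ) :
    (∀ x S, (π.law x S t).toReal = π.likelihood x (fun i => decide (i ∈ S)) [] t) ∨
      ∀ x S, (π.law x S t).toReal = 0 := by
  rcases π.run_eq_likelihood_or_zero π.length [] t with h | h
  · left; intro x S; exact h x _
  · right; intro x S; exact h x _

/-- Without leakers the secret is never consulted, so this law serves as one reference measure for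
all secrets. -/
theorem law_empty_eq (π : Protocol n 𝒳) (x x' : 𝒳) : π.law x ∅ = π.law x' ∅ := by
  suffices h : ∀ k t, π.run x (fun _ => false) k t = π.run x' (fun _ => false) k t by
    simpa [law] using h π.length []
  intro k
  induction k with
  | zero => intro t; rfl
  | succ k ih => intro t; simp only [run, ih]; rfl

theorem next_eq_none_of_run_ne_zero (π : Protocol n 𝒳) (x : 𝒳) (ℓ : Fin n → Bool) (k : ℕ)
    (t₀ t : List ℕ) (hk : π.length ≤ t₀.length + k) (h : π.run x ℓ k t₀ t ≠ 0) :
    π.next t = none := by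
  induction k generalizing t₀ with
  | zero =>
    simp only [run, PMF.pure_apply, ne_eq, ite_eq_right_iff, one_ne_zero, imp_false,
      not_not] at h
    exact h ▸ π.terminates _ (by simpa using hk)
  | succ k ih =>
    rw [run] at h
    split at h
    · rename_i hn
      simp only [PMF.pure_apply, ne_eq, ite_eq_right_iff, one_ne_zero, imp_false,
        not_not] at h
      exact h ▸ hn
    · rw [← PMF.mem_support_iff, PMF.mem_support_bind_iff] at h
      obtain ⟨m, -, hm⟩ := h
      exact ih (t₀ ++ [m]) (by simp; omega) ((PMF.mem_support_iff _ _).mp hm)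

theorem run_support_induction (π : Protocol n 𝒳) (x : 𝒳) (ℓ : Fin n → Bool)
    (I : List ℕ → Prop)
    (hI : ∀ t i m, I t → π.next t = some i →
      (if ℓ i = true then π.leaking t x else π.ignorant t) m ≠ 0 → I (t ++ [m]))
    (k : ℕ) (t₀ t : List ℕ) (h₀ : I t₀) (h : π.run x ℓ k t₀ t ≠ 0) : I t := by
  induction k generalizing t₀ with
  | zero =>
    simp only [run, PMF.pure_apply, ne_eq, ite_eq_right_iff, one_ne_zero, imp_false,
      not_not] at h
    exact h ▸ h₀
  | succ k ih =>
    rw [run] at h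
    split at h
    · simp only [PMF.pure_apply, ne_eq, ite_eq_right_iff, one_ne_zero, imp_false,
        not_not] at h
      exact h ▸ h₀
    · rename_i i hn
      rw [← PMF.mem_support_iff, PMF.mem_support_bind_iff] at h
      obtain ⟨m, hm', hm⟩ := h
      exact ih (t₀ ++ [m]) (hI _ _ _ h₀ hn hm') ((PMF.mem_support_iff _ _).mp hm)

/-- A supermartingale bound: a potential that does not grow in expectation in one step does not grow
over the run. -/
theorem tsum_run_mul_le (π : Protocol n 𝒳) (x : 𝒳) (ℓ : Fin n → Bool)
    (Φ : List ℕ → ENNReal)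
    (hΦ : ∀ t i, π.next t = some i →
      ∑' m, (if ℓ i = true then π.leaking t x else π.ignorant t) m * Φ (t ++ [m]) ≤ Φ t)
    (k : ℕ) (t₀ : List ℕ) : ∑' t, π.run x ℓ k t₀ t * Φ t ≤ Φ t₀ := by
  have hpure : ∀ t₀, ∑' t, PMF.pure t₀ t * Φ t = Φ t₀ := by
    intro t₀
    rw [tsum_eq_single t₀ (by intro t ht; simp [ht])]
    simp
  induction k generalizing t₀ with
  | zero => exact (hpure t₀).le
  | succ k ih =>
    rw [run]
    split
    · exact (hpure t₀).le
    · rename_i i hn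
      refine le_trans ?_ (hΦ t₀ i hn)
      simp only [PMF.bind_apply]
      simp_rw [← ENNReal.tsum_mul_right]
      rw [ENNReal.tsum_comm]
      refine ENNReal.tsum_le_tsum fun m => ?_
      simp_rw [mul_assoc]
      rw [ENNReal.tsum_mul_left]
      gcongr
      exact ih _

section Fixed

variable [Fintype 𝒳] [Nonempty 𝒳] {l : ℕ}

theorem prob_joint_fixed (π : Protocol n 𝒳) (hln : l ≤ n) (x : 𝒳)
    (G : (Fin n → Bool) → List ℕ → Prop) :
    prob (π.joint (fixed l n hln)) {ω | ω.1 = x ∧ G ω.2.1 ω.2.2} =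
      ((Fintype.card 𝒳 : ℝ) * (n.choose l : ℝ))⁻¹ *
        ∑ S ∈ powersetCard l (univ : Finset (Fin n)),
          prob (π.law x S) {t | G (fun i => decide (i ∈ S)) t} := by
  classical
  have h : (π.joint (fixed l n hln)).toOuterMeasure {ω | ω.1 = x ∧ G ω.2.1 ω.2.2} =
      (Fintype.card 𝒳 : ENNReal)⁻¹ * ((n.choose l : ENNReal)⁻¹ *
        ∑ S ∈ powersetCard l (univ : Finset (Fin n)),
          (π.law x S).toOuterMeasure {t | G (fun i => decide (i ∈ S)) t}) := by
    rw [joint, PMF.toOuterMeasure_bind_apply, tsum_eq_single x]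
    · rw [PMF.uniformOfFintype_apply, fixed, PMF.bind_map, PMF.toOuterMeasure_bind_apply,
        tsum_eq_sum (s := powersetCard l (univ : Finset (Fin n))) ?_]
      · congr 1
        rw [Finset.mul_sum]
        refine Finset.sum_congr rfl fun S hS => ?_
        rw [PMF.uniformOfFinset_apply_of_mem _ hS]
        simp only [card_powersetCard, card_univ, Fintype.card_fin, Function.comp]
        rw [PMF.toOuterMeasure_map_apply]
        congr 2
        ext t
        simp
      · intro S hS
        rw [PMF.uniformOfFinset_apply_of_notMem _ hS, zero_mul]
    · intro y hy
      rw [PMF.toOuterMeasure_bind_apply]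
      refine mul_eq_zero_of_right _ (ENNReal.tsum_eq_zero.mpr fun ℓ => mul_eq_zero_of_right _ ?_)
      rw [PMF.toOuterMeasure_map_apply]
      simp [hy]
  rw [prob, h]
  simp only [ENNReal.toReal_mul, ENNReal.toReal_inv, ENNReal.toReal_natCast]
  rw [ENNReal.toReal_sum, mul_inv, mul_assoc]
  · rfl
  · exact fun S _ => toOuterMeasure_ne_top _ _

theorem prefactor_pos (hln : l ≤ n) :
    0 < ((Fintype.card 𝒳 : ℝ) * (n.choose l : ℝ))⁻¹ := by
  have := Nat.choose_pos hln
  have : 0 < Fintype.card 𝒳 := Fintype.card_pos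
  positivity

theorem prob_transcript_secret (π : Protocol n 𝒳) (hln : l ≤ n) (x : 𝒳) (t : List ℕ) :
    prob (π.joint (fixed l n hln)) {ω | ω.2.2 = t ∧ ω.1 = x} =
      ((Fintype.card 𝒳 : ℝ) * (n.choose l : ℝ))⁻¹ *
        ∑ S ∈ powersetCard l (univ : Finset (Fin n)), (π.law x S t).toReal := by
  have h := π.prob_joint_fixed hln x (fun _ s => s = t)
  simp only [and_comm] at h ⊢
  rw [h]
  simp only [Set.ofPred_eq_eq_singleton, prob_singleton]

theorem posterior_fixed (π : Protocol n 𝒳) (hln : l ≤ n) (i : Fin n) (t : List ℕ) (x : 𝒳) :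
    π.posterior (fixed l n hln) i t x =
      (∑ S ∈ powersetCard l (univ : Finset (Fin n)) with i ∈ S, (π.law x S t).toReal) /
        ∑ S ∈ powersetCard l (univ : Finset (Fin n)), (π.law x S t).toReal := by
  classical
  rw [posterior, condProb, prob_transcript_secret]
  have h := π.prob_joint_fixed hln x (fun ℓ s => ℓ i = true ∧ s = t)
  have hset : ({ω : 𝒳 × (Fin n → Bool) × List ℕ | ω.2.1 i = true} ∩
      {ω | ω.2.2 = t ∧ ω.1 = x}) = {ω | ω.1 = x ∧ ω.2.1 i = true ∧ ω.2.2 = t} := by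
    ext ω; simp only [Set.mem_inter_iff, Set.mem_ofPred_eq]; tauto
  rw [hset, h, mul_div_mul_left _ _ (prefactor_pos hln).ne', Finset.sum_filter]
  congr 1
  refine Finset.sum_congr rfl fun S _ => ?_
  by_cases hi : i ∈ S
  · simp [hi, prob_singleton]
  · simp [hi, prob]

theorem condProb_secret_fixed (π : Protocol n 𝒳) (hln : l ≤ n) (x : 𝒳) (G : List ℕ → Prop) :
    condProb (π.joint (fixed l n hln)) {ω | G ω.2.2} {ω | ω.1 = x} =
      (n.choose l : ℝ)⁻¹ *
        ∑ S ∈ powersetCard l (univ : Finset (Fin n)), prob (π.law x S) {t | G t} := by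
  have h := π.prob_joint_fixed hln x (fun _ t => G t)
  have h1 := π.prob_joint_fixed hln x (fun _ _ => True)
  simp only [and_true, Set.ofPred_true, prob_univ, sum_const, card_powersetCard, card_univ,
    Fintype.card_fin, nsmul_eq_mul, mul_one] at h1
  rw [condProb, Set.inter_comm, h1]
  have hset : ({ω : 𝒳 × (Fin n → Bool) × List ℕ | ω.1 = x} ∩ {ω | G ω.2.2}) =
    {ω | ω.1 = x ∧ G ω.2.2} := rfl
  rw [hset, h, mul_div_mul_left _ _ (prefactor_pos hln).ne', div_eq_inv_mul]

end Fixed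

end Protocol

/-! ### Converse: entropy inequalities for a single player. -/

/-- The concavity of `log` as a bound on the binary cross entropy. -/
theorem mul_log_add_binary_le_log_one_add {q w : ℝ} (hq : q ∈ Set.Ioo (0 : ℝ) 1) (hw : 0 < w) :
    q * Real.log w - q * Real.log q - (1 - q) * Real.log (1 - q) ≤ Real.log (1 + w) := by
  obtain ⟨h0, h1⟩ := hq
  have h1' : 0 < 1 - q := by linarith
  have h := strictConcaveOn_log_Ioi.concaveOn.2 (x := w / q) (y := 1 / (1 - q))
    (Set.mem_Ioi.mpr (by positivity)) (Set.mem_Ioi.mpr (by positivity)) h0.le h1'.le (by ring)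
  simp only [smul_eq_mul] at h
  rw [Real.log_div hw.ne' h0.ne', Real.log_div one_ne_zero h1'.ne', Real.log_one,
    mul_div_cancel₀ _ h0.ne', mul_div_cancel₀ _ h1'.ne', add_comm w] at h
  linarith

/-- The function -log(1-p) is convex and vanishes at 0, so it lies below its chord on [0, c]. The
slope of this chord is the main term of the capacity. -/
theorem neg_log_one_sub_le_chord {c p : ℝ} (hc : c ∈ Set.Ioo (0 : ℝ) 1) (hp0 : 0 ≤ p)
    (hpc : p ≤ c) : -Real.log (1 - p) ≤ p * (-Real.log (1 - c) / c) := by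
  obtain ⟨h0, h1⟩ := hc
  have ha : 0 ≤ p / c := by positivity
  have hb : 0 ≤ 1 - p / c := by rw [sub_nonneg, div_le_one h0]; exact hpc
  have h := strictConcaveOn_log_Ioi.concaveOn.2 (x := 1 - c) (y := 1)
    (Set.mem_Ioi.mpr (by linarith)) (Set.mem_Ioi.mpr one_pos) ha hb (by ring)
  simp only [smul_eq_mul, Real.log_one, mul_zero, add_zero, mul_one] at h
  have e : p / c * (1 - c) + (1 - p / c) = 1 - p := by field_simp; ring
  rw [e] at h
  have : p * (-Real.log (1 - c) / c) = -(p / c * Real.log (1 - c)) := by ring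
  linarith

/-- The optimal tilt of a single player, and the resulting bound. -/
theorem exists_tilt {c η p w : ℝ} (hc : c ∈ Set.Ioo (0 : ℝ) 1) (hη : 0 < η)
    (hηc : (1 + η) * c < 1) (hp0 : 0 ≤ p) (hpc : p ≤ c) (hw : 0 ≤ w) (hwp : w = 0 → p = 0) :
    ∃ y : ℝ, 0 < y ∧ (1 + η) * (Real.log (1 + w * y) - p * Real.log y) ≤
      Real.log (1 + w) + η * p * (-Real.log (1 - c) / c + η / (1 - c)) := by
  rcases hw.eq_or_lt with hw0 | hw0
  · refine ⟨1, one_pos, ?_⟩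
    simp [← hw0, hwp hw0.symm]
  rcases hp0.eq_or_lt with hp | hp
  -- For p = 0 this solves (1 + w * y)^(1+η) = 1 + w, giving equality.
  · refine ⟨((1 + w) ^ (1 / (1 + η)) - 1) / w, ?_, ?_⟩
    · have : 1 < (1 + w) ^ (1 / (1 + η)) := Real.one_lt_rpow (by linarith) (by positivity)
      exact div_pos (by linarith) hw0
    · rw [mul_div_cancel₀ _ hw0.ne', ← hp, add_sub_cancel, Real.log_rpow (by linarith)]
      have : (1 + η) ≠ 0 := by positivity
      field_simp
      simp
  have h1c : 0 < 1 - c := by linarith [hc.2]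
  have h1p : 0 < 1 - p := by linarith [hc.2]
  have hq1 : (1 + η) * p < 1 := lt_of_le_of_lt (by gcongr) hηc
  -- The entropy bound is taken at (1+η)p. The error (1+η)h(p) - h((1+η)p), with h the binary
  -- entropy, is -η log(1-p) to first order in η.
  have hq := mul_log_add_binary_le_log_one_add (q := (1 + η) * p)
    ⟨by positivity, hq1⟩ hw0
  -- The minimizer of log(1 + w * y) - p log y: the tilted odds w * y equal p/(1-p).
  refine ⟨p / ((1 - p) * w), by positivity, ?_⟩
  have e1 : 1 + w * (p / ((1 - p) * w)) = (1 - p)⁻¹ := by field_simp; ring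
  rw [e1, Real.log_inv, Real.log_div hp.ne' (by positivity), Real.log_mul h1p.ne' hw0.ne']
  rw [Real.log_mul (by positivity) hp.ne'] at hq
  have hA : Real.log (1 - (1 + η) * p) ≤ Real.log (1 - p) - η * p / (1 - p) := by
    have : 1 - (1 + η) * p = (1 - p) * (1 - η * p / (1 - p)) := by field_simp; ring
    have hpos : 0 < 1 - η * p / (1 - p) := by
      rw [sub_pos, div_lt_one h1p]; linarith
    rw [this, Real.log_mul h1p.ne' hpos.ne']
    linarith [Real.log_le_sub_one_of_pos hpos]
  have hB : Real.log (1 + η) ≤ η := by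
    linarith [Real.log_le_sub_one_of_pos (show 0 < 1 + η by linarith)]
  have hC := neg_log_one_sub_le_chord hc hp.le hpc
  have hD : η / (1 - p) ≤ η / (1 - c) := by gcongr
  have hA' := mul_le_mul_of_nonneg_left hA (show 0 ≤ 1 - (1 + η) * p by linarith)
  have hB' := mul_le_mul_of_nonneg_left hB (show 0 ≤ (1 + η) * p by positivity)
  have hC' := mul_le_mul_of_nonneg_left hC hη.le
  have hD' := mul_le_mul_of_nonneg_left hD (show 0 ≤ η * p by positivity)
  have e2 : (1 + η) * p * η - (1 - (1 + η) * p) * (η * p / (1 - p)) = η * p * (η / (1 - p)) := by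
    field_simp; ring
  linarith

/-! ### Converse: elementary symmetric sums with bounded marginals. -/

section Symmetric

variable {n l : ℕ}

/-- The weight of the `l`-element sets, for the weights `w` of the players. -/
noncomputable def weightSum (l : ℕ) (w : Fin n → ℝ) : ℝ :=
  ∑ S ∈ powersetCard l (univ : Finset (Fin n)), ∏ i ∈ S, w i

/-- The probability that player `i` belongs to a random `l`-element set, drawn with probability
proportional to the product of the weights `w`. -/
noncomputable def marginal (l : ℕ) (w : Fin n → ℝ) (i : Fin n) : ℝ :=
  (∑ S ∈ powersetCard l (univ : Finset (Fin n)) with i ∈ S, ∏ i ∈ S, w i) / weightSum l w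

theorem sum_marginal_mul {w : Fin n → ℝ} (a : Fin n → ℝ) :
    ∑ i, marginal l w i * a i =
      ∑ S ∈ powersetCard l (univ : Finset (Fin n)),
        (∏ i ∈ S, w i) / weightSum l w * ∑ i ∈ S, a i := by
  simp_rw [marginal, Finset.sum_filter, Finset.sum_div, Finset.sum_mul]
  rw [Finset.sum_comm]
  refine Finset.sum_congr rfl fun S _ => ?_
  rw [Finset.mul_sum, ← Finset.sum_filter_add_sum_filter_not univ (· ∈ S)]
  rw [Finset.sum_eq_zero (s := univ.filter (· ∉ S))]
  · rw [add_zero]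
    simp only [Finset.filter_mem_eq_inter, univ_inter]
    refine Finset.sum_congr rfl fun i hi => ?_
    simp [hi]
  · intro i hi
    simp only [mem_filter, mem_univ, true_and] at hi
    simp [hi]

theorem sum_weight_div {w : Fin n → ℝ} (hf : 0 < weightSum l w) :
    ∑ S ∈ powersetCard l (univ : Finset (Fin n)), (∏ i ∈ S, w i) / weightSum l w = 1 := by
  rw [← Finset.sum_div]
  exact div_self hf.ne'

theorem sum_marginal {w : Fin n → ℝ} (hf : 0 < weightSum l w) :
    ∑ i, marginal l w i = l := by
  have h := sum_marginal_mul (l := l) (w := w) (fun _ => 1)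
  simp only [mul_one, sum_const, nsmul_eq_mul] at h
  rw [h]
  trans ∑ S ∈ powersetCard l (univ : Finset (Fin n)), (∏ i ∈ S, w i) / weightSum l w * l
  · refine Finset.sum_congr rfl fun S hS => ?_
    rw [(mem_powersetCard.mp hS).2]
  · rw [← Finset.sum_mul, sum_weight_div hf, one_mul]

theorem marginal_nonneg {w : Fin n → ℝ} (hw : ∀ i, 0 ≤ w i) (i : Fin n) : 0 ≤ marginal l w i :=
  div_nonneg (Finset.sum_nonneg fun _ _ => Finset.prod_nonneg fun _ _ => hw _)
    (Finset.sum_nonneg fun _ _ => Finset.prod_nonneg fun _ _ => hw _)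

theorem marginal_eq_zero {w : Fin n → ℝ} {i : Fin n} (hi : w i = 0) : marginal l w i = 0 := by
  rw [marginal, Finset.sum_eq_zero, zero_div]
  intro S hS
  exact Finset.prod_eq_zero (mem_filter.mp hS).2 hi

theorem weightSum_le_prod {w : Fin n → ℝ} (hw : ∀ i, 0 ≤ w i) :
    weightSum l w ≤ ∏ i, (1 + w i) := by
  rw [Finset.prod_one_add]
  exact Finset.sum_le_sum_of_subset_of_nonneg
    (fun S _ => mem_powerset.mpr (subset_univ S))
    fun _ _ _ => Finset.prod_nonneg fun _ _ => hw _

/-- Jensen for `log` of ∏ i ∈ S, y i over the random set S with law proportional to ∏ i ∈ S, w i;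
the tilted sum is then bounded by dropping the size constraint on S. -/
theorem log_weightSum_add_le {w y : Fin n → ℝ} (hw : ∀ i, 0 ≤ w i) (hy : ∀ i, 0 < y i)
    (hf : 0 < weightSum l w) :
    Real.log (weightSum l w) + ∑ i, marginal l w i * Real.log (y i) ≤
      ∑ i, Real.log (1 + w i * y i) := by
  rw [sum_marginal_mul]
  have hjensen := strictConcaveOn_log_Ioi.concaveOn.le_map_sum
    (t := powersetCard l (univ : Finset (Fin n)))
    (w := fun S => (∏ i ∈ S, w i) / weightSum l w) (p := fun S => ∏ i ∈ S, y i)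
    (fun S _ => div_nonneg (Finset.prod_nonneg fun _ _ => hw _) hf.le) (sum_weight_div hf)
    (fun S _ => Set.mem_Ioi.mpr (Finset.prod_pos fun _ _ => hy _))
  simp only [smul_eq_mul] at hjensen
  have e : ∑ S ∈ powersetCard l (univ : Finset (Fin n)),
      (∏ i ∈ S, w i) / weightSum l w * ∏ i ∈ S, y i =
        weightSum l (fun i => w i * y i) / weightSum l w := by
    conv_rhs => rw [weightSum, Finset.sum_div]
    refine Finset.sum_congr rfl fun S _ => ?_
    rw [Finset.prod_mul_distrib]
    ring
  have hpos : 0 < weightSum l (fun i => w i * y i) := by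
    obtain ⟨S, hS, hne⟩ := Finset.exists_ne_zero_of_sum_ne_zero hf.ne'
    refine Finset.sum_pos' (fun _ _ => Finset.prod_nonneg fun i _ => mul_nonneg (hw i) (hy i).le)
      ⟨S, hS, ?_⟩
    rw [Finset.prod_mul_distrib]
    exact mul_pos ((Finset.prod_nonneg fun _ _ => hw _).lt_of_ne' hne)
      (Finset.prod_pos fun _ _ => hy _)
  rw [e, Real.log_div hpos.ne' hf.ne'] at hjensen
  have hlog : Real.log (weightSum l fun i => w i * y i) ≤ ∑ i, Real.log (1 + w i * y i) := by
    rw [← Real.log_prod fun i _ => by have := mul_nonneg (hw i) (hy i).le; positivity]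
    exact Real.log_le_log hpos (weightSum_le_prod fun i => mul_nonneg (hw i) (hy i).le)
  have e2 : ∑ S ∈ powersetCard l (univ : Finset (Fin n)),
      (∏ i ∈ S, w i) / weightSum l w * ∑ i ∈ S, Real.log (y i) =
      ∑ S ∈ powersetCard l (univ : Finset (Fin n)),
      (∏ i ∈ S, w i) / weightSum l w * Real.log (∏ i ∈ S, y i) := by
    refine Finset.sum_congr rfl fun S _ => ?_
    rw [Real.log_prod fun i _ => (hy i).ne']
  linarith

/-- Each player is tilted optimally for its own marginal. The single-player errors are proportional
to the marginals, which sum to l. -/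
theorem log_weightSum_le {c η : ℝ} {w : Fin n → ℝ} (hc : c ∈ Set.Ioo (0 : ℝ) 1) (hη : 0 < η)
    (hηc : (1 + η) * c < 1) (hw : ∀ i, 0 ≤ w i) (hf : 0 < weightSum l w)
    (hp : ∀ i, marginal l w i ≤ c) :
    (1 + η) * Real.log (weightSum l w) ≤
      Real.log (∏ i, (1 + w i)) + η * l * (-Real.log (1 - c) / c + η / (1 - c)) := by
  choose y hy0 hy using fun i => exists_tilt hc hη hηc (marginal_nonneg (l := l) hw i) (hp i)
    (hw i) marginal_eq_zero
  have h := log_weightSum_add_le hw hy0 hf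
  have hs := Finset.sum_le_sum fun i (_ : i ∈ univ) => hy i
  rw [← Finset.mul_sum, Finset.sum_sub_distrib, Finset.sum_add_distrib, ← Finset.sum_mul,
    ← Finset.mul_sum, sum_marginal hf] at hs
  rw [Real.log_prod fun i _ => by have := hw i; positivity]
  have := mul_le_mul_of_nonneg_left h (show 0 ≤ 1 + η by linarith)
  linarith

end Symmetric

/-! ### Converse: the normalizing binomial term. -/

section Binomial

/-- The ratio of consecutive terms k^k/k! is (1 + 1/k)^k ≤ e. -/
theorem succ_pow_div_factorial_le (k : ℕ) :
    ((k + 1 : ℕ) : ℝ) ^ (k + 1) / (k + 1).factorial ≤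
      Real.exp 1 * ((k : ℝ) ^ k / k.factorial) := by
  have e : ((k + 1 : ℕ) : ℝ) ^ (k + 1) / (k + 1).factorial = ((k : ℝ) + 1) ^ k / k.factorial := by
    rw [Nat.factorial_succ]; push_cast; field_simp; ring
  rw [e, ← mul_div_assoc]
  gcongr
  rcases Nat.eq_zero_or_pos k with rfl | hk
  · simp
  have hk' : (0 : ℝ) < k := by exact_mod_cast hk
  have h : ((k : ℝ) + 1) ≤ Real.exp (1 / k) * k := by
    have := Real.add_one_le_exp (1 / (k : ℝ))
    calc (k : ℝ) + 1 = (1 / k + 1) * k := by field_simp; ring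
      _ ≤ _ := by gcongr
  calc ((k : ℝ) + 1) ^ k ≤ (Real.exp (1 / k) * k) ^ k := by gcongr
    _ = _ := by
      rw [mul_pow, ← Real.exp_nat_mul, mul_one_div_cancel hk'.ne']

theorem add_pow_div_factorial_le (k l : ℕ) :
    ((k + l : ℕ) : ℝ) ^ (k + l) / (k + l).factorial ≤
      Real.exp l * ((k : ℝ) ^ k / k.factorial) := by
  induction l with
  | zero => simp
  | succ l ih =>
    refine (succ_pow_div_factorial_le (k + l)).trans ?_
    push_cast at ih ⊢
    rw [Real.exp_add, mul_comm (Real.exp l), mul_assoc]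
    gcongr

/-- A weak Stirling bound k! ≤ e * k * (k/e)^k for k = l + 1, by induction from e ≤ (1 + 1/k)^(k+1).
-/
theorem exp_mul_factorial_le (l : ℕ) :
    Real.exp (l + 1 : ℕ) * (l + 1).factorial ≤
      Real.exp 1 * (l + 1 : ℕ) * ((l + 1 : ℕ) : ℝ) ^ (l + 1) := by
  induction l with
  | zero => simp
  | succ l ih =>
    rw [Nat.factorial_succ]
    set k : ℕ := l + 1 with hk
    have hk0 : (0 : ℝ) < k := by positivity
    have h1 : Real.exp 1 * (k : ℝ) ^ (k + 1) ≤ ((k : ℝ) + 1) ^ (k + 1) := by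
      have hexp : Real.exp (1 / ((k : ℝ) + 1)) ≤ ((k : ℝ) + 1) / k := by
        have h2 := Real.add_one_le_exp (-(1 / ((k : ℝ) + 1)))
        have h3 : (k : ℝ) / (k + 1) ≤ Real.exp (-(1 / ((k : ℝ) + 1))) := by
          refine le_trans (le_of_eq ?_) h2
          field_simp; ring
        rw [Real.exp_neg] at h3
        rw [← inv_div (k : ℝ)]
        exact (le_inv_comm₀ (by positivity) (Real.exp_pos _)).mp h3
      have h4 := pow_le_pow_left₀ (Real.exp_pos _).le hexp (k + 1)
      rw [← Real.exp_nat_mul, div_pow] at h4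
      push_cast at h4
      rw [mul_one_div_cancel (by positivity), le_div_iff₀ (by positivity)] at h4
      exact h4
    push_cast
    rw [Real.exp_add]
    calc Real.exp k * Real.exp 1 * (((k : ℝ) + 1) * k.factorial)
        = Real.exp 1 * (k + 1) * (Real.exp k * k.factorial) := by ring
      _ ≤ Real.exp 1 * (k + 1) * (Real.exp 1 * k * (k : ℝ) ^ k) := by gcongr
      _ = Real.exp 1 * (k + 1) * (Real.exp 1 * (k : ℝ) ^ (k + 1)) := by ring
      _ ≤ Real.exp 1 * (k + 1) * ((k : ℝ) + 1) ^ (k + 1) := by gcongr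

/-- A binomial variable with parameters `n` and `l / n` takes the value `l` with probability at
least `1 / (e l)`. -/
theorem one_add_pow_le_choose {n l : ℕ} (hl : 0 < l) (hln : l < n) :
    (1 + (l : ℝ) / (n - l)) ^ n ≤
      Real.exp 1 * l * (n.choose l * ((l : ℝ) / (n - l)) ^ l) := by
  obtain ⟨k, rfl⟩ := Nat.exists_eq_add_of_lt hln
  set j := k + 1 with hj
  have hsum : l + k + 1 = j + l := by omega
  rw [hsum]
  have hcast : (((j + l : ℕ) : ℝ) - l) = j := by push_cast; ring
  have hj0 : (0 : ℝ) < j := by positivity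
  clear_value j
  have hl0 : (0 : ℝ) < l := by exact_mod_cast hl
  have h1 := add_pow_div_factorial_le j l
  obtain ⟨l', rfl⟩ := Nat.exists_eq_succ_of_ne_zero hl.ne'
  have h2 := exp_mul_factorial_le l'
  rw [Nat.succ_eq_add_one] at *
  set l := l' + 1 with hl'
  rw [hcast, Nat.cast_choose ℝ (Nat.le_add_left l j), Nat.add_sub_cancel]
  have e1 : (1 + (l : ℝ) / j) ^ (j + l) = ((j + l : ℕ) : ℝ) ^ (j + l) / (j : ℝ) ^ (j + l) := by
    rw [← div_pow]; congr 1; push_cast; field_simp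
  have hf1 : (0 : ℝ) < (j + l).factorial := by exact_mod_cast Nat.factorial_pos _
  have hf2 : (0 : ℝ) < j.factorial := by exact_mod_cast Nat.factorial_pos _
  have hf3 : (0 : ℝ) < l.factorial := by exact_mod_cast Nat.factorial_pos _
  rw [e1, div_pow]
  rw [div_le_iff₀ hf1] at h1
  calc ((j + l : ℕ) : ℝ) ^ (j + l) / (j : ℝ) ^ (j + l)
      ≤ (Real.exp l * ((j : ℝ) ^ j / j.factorial) * (j + l).factorial) / (j : ℝ) ^ (j + l) := by
        gcongr
    _ = (Real.exp l * l.factorial) * ((j + l).factorial / (l.factorial * j.factorial) /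
          (j : ℝ) ^ l) := by
        rw [pow_add]; field_simp
    _ ≤ (Real.exp 1 * l * (l : ℝ) ^ l) * ((j + l).factorial / (l.factorial * j.factorial) /
          (j : ℝ) ^ l) := by gcongr
    _ = _ := by ring

/-- The base is 1/(1 - l/n) ≥ e^(l/n). This is the source of the term -log₂ e in the capacity. -/
theorem exp_le_one_add_pow {n l : ℕ} (hln : l < n) :
    Real.exp l ≤ (1 + (l : ℝ) / (n - l)) ^ n := by
  have hn : (0 : ℝ) < n := by exact_mod_cast lt_of_le_of_lt (Nat.zero_le _) hln
  have hnl : (0 : ℝ) < n - l := by rw [sub_pos]; exact_mod_cast hln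
  have h : Real.exp ((l : ℝ) / n) ≤ 1 + (l : ℝ) / (n - l) := by
    have h2 := Real.add_one_le_exp (-((l : ℝ) / n))
    have h3 : ((n : ℝ) - l) / n ≤ Real.exp (-((l : ℝ) / n)) := by
      refine le_trans (le_of_eq ?_) h2
      field_simp; ring
    rw [Real.exp_neg] at h3
    have e : 1 + (l : ℝ) / (n - l) = (((n : ℝ) - l) / n)⁻¹ := by field_simp; ring
    rw [e]
    exact (le_inv_comm₀ (by positivity) (Real.exp_pos _)).mp h3
  have h4 := pow_le_pow_left₀ (Real.exp_pos _).le h n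
  rwa [← Real.exp_nat_mul, mul_div_cancel₀ _ hn.ne'] at h4

end Binomial

/-! ### Converse: product form of likelihoods and the count of secrets. -/

namespace Protocol

variable {n : ℕ} {𝒳 : Type*}

theorem exists_likelihood_eq_prod (π : Protocol n 𝒳) (t s : List ℕ) :
    ∃ (u : Fin n → ℝ) (v : 𝒳 → Fin n → ℝ), (∀ i, 0 ≤ u i) ∧ (∀ x i, 0 ≤ v x i) ∧
      ∀ x ℓ, π.likelihood x ℓ t s = ∏ i, if ℓ i = true then v x i else u i := by
  induction s generalizing t with
  | nil => exact ⟨fun _ => 1, fun _ _ => 1, by simp, by simp, by simp [likelihood]⟩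
  | cons m s ih =>
    obtain ⟨u, v, hu, hv, h⟩ := ih (t ++ [m])
    rcases hn : π.next t with _ | j
    · exact ⟨u, v, hu, hv, fun x ℓ => by rw [likelihood, h, messageProb, hn, one_mul]⟩
    · refine ⟨fun i => (if i = j then (π.ignorant t m).toReal else 1) * u i,
        fun x i => (if i = j then (π.leaking t x m).toReal else 1) * v x i, fun i => ?_,
        fun x i => ?_, fun x ℓ => ?_⟩
      · refine mul_nonneg ?_ (hu i)
        split
        · exact ENNReal.toReal_nonneg
        · exact zero_le_one
      · refine mul_nonneg ?_ (hv x i)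
        split
        · exact ENNReal.toReal_nonneg
        · exact zero_le_one
      · rw [likelihood, h, messageProb, hn]
        have e : ∀ i, (if ℓ i = true then (if i = j then (π.leaking t x m).toReal else 1) * v x i
            else (if i = j then (π.ignorant t m).toReal else 1) * u i) =
            (if i = j then ((if ℓ j = true then π.leaking t x else π.ignorant t) m).toReal else 1) *
              (if ℓ i = true then v x i else u i) := by
          intro i
          by_cases hi : i = j
          · subst hi
            by_cases hl : ℓ i = true <;> simp [hl]
          · by_cases hl : ℓ i = true <;> simp [hi, hl]
        simp_rw [e]
        rw [Finset.prod_mul_distrib, Finset.prod_ite_eq' univ j]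
        simp

theorem exists_law_eq_mul_prod (π : Protocol n 𝒳) {l : ℕ} (x : 𝒳) (t : List ℕ)
    (hpos : 0 < ∑ S ∈ powersetCard l (univ : Finset (Fin n)), (π.law x S t).toReal)
    (hlt : ∀ i, ∑ S ∈ powersetCard l (univ : Finset (Fin n)) with i ∈ S, (π.law x S t).toReal <
      ∑ S ∈ powersetCard l (univ : Finset (Fin n)), (π.law x S t).toReal) :
    ∃ z : Fin n → ℝ, (∀ i, 0 ≤ z i) ∧ 0 < (π.law x ∅ t).toReal ∧
      ∀ S, (π.law x S t).toReal = (π.law x ∅ t).toReal * ∏ i ∈ S, z i := by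
  rcases π.law_eq_likelihood_or_zero t with h | h
  swap
  · simp [h] at hpos
  obtain ⟨u, v, hu, hv, huv⟩ := π.exists_likelihood_eq_prod [] t
  have hlaw : ∀ S, (π.law x S t).toReal = ∏ i, if i ∈ S then v x i else u i := by
    intro S
    rw [h, huv]
    simp
  -- If `u i` vanished, every possible set of leakers would contain `i`, contradicting `hlt`. Hence
  -- the likelihood ratios v/u exist.
  have hupos : ∀ i, 0 < u i := by
    intro i
    refine (hu i).lt_of_ne' fun h0 => (hlt i).ne ?_
    rw [Finset.sum_filter]
    refine Finset.sum_congr rfl fun S _ => ?_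
    split
    · rfl
    · rename_i hi
      rw [hlaw, Finset.prod_eq_zero (mem_univ i)]
      simp [hi, h0]
  refine ⟨fun i => v x i / u i, fun i => div_nonneg (hv x i) (hu i), ?_, fun S => ?_⟩
  · rw [hlaw]
    simpa using Finset.prod_pos fun i _ => hupos i
  · rw [hlaw, hlaw]
    simp only [notMem_empty, if_false]
    have e : ∀ i, (if i ∈ S then v x i else u i) = u i * if i ∈ S then v x i / u i else 1 := by
      intro i
      split
      · rw [mul_div_cancel₀ _ (hupos i).ne']
      · rw [mul_one]
    simp_rw [e]
    rw [Finset.prod_mul_distrib, Finset.prod_ite_mem, univ_inter]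

end Protocol

theorem weightSum_smul {n l : ℕ} (a : ℝ) (z : Fin n → ℝ) :
    weightSum l (fun i => a * z i) = a ^ l * weightSum l z := by
  rw [weightSum, weightSum, Finset.mul_sum]
  refine Finset.sum_congr rfl fun S hS => ?_
  rw [Finset.prod_mul_distrib, Finset.prod_const, (mem_powersetCard.mp hS).2]

/-- All sets have size l, so a common factor cancels. The likelihood ratios may thus be rescaled by
the odds l/(n-l) without changing posteriors. -/
theorem marginal_smul {n l : ℕ} {a : ℝ} (ha : a ≠ 0) (z : Fin n → ℝ) (i : Fin n) :
    marginal l (fun i => a * z i) i = marginal l z i := by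
  rw [marginal, marginal, weightSum_smul,
    ← mul_div_mul_left _ (weightSum l z) (pow_ne_zero l ha), Finset.mul_sum]
  congr 1
  refine Finset.sum_congr rfl fun S hS => ?_
  rw [Finset.prod_mul_distrib, Finset.prod_const,
    (mem_powersetCard.mp (mem_filter.mp hS).1).2]

/-- A bound for the ratio between the probabilities of a good transcript with and without
leakers. -/
noncomputable def ratioBound (c η : ℝ) (l : ℕ) : ℝ :=
  Real.exp (Real.log (4 * (Real.exp 1 * l)) / η + l * (-Real.log (1 - c) / c + η / (1 - c))) *
    (Real.exp 1 * l * Real.exp (-l))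

namespace Protocol

variable {n : ℕ} {𝒳 : Type*}

theorem posterior_eq_marginal [Fintype 𝒳] [Nonempty 𝒳] (π : Protocol n 𝒳) {l : ℕ} (hln : l ≤ n)
    (x : 𝒳) (t : List ℕ) (i : Fin n) {q : ℝ} (hq : q ≠ 0) {z : Fin n → ℝ}
    (hz : ∀ S, (π.law x S t).toReal = q * ∏ i ∈ S, z i) :
    π.posterior (fixed l n hln) i t x = marginal l z i := by
  rw [posterior_fixed]
  simp_rw [hz]
  rw [← Finset.mul_sum, ← Finset.mul_sum, mul_div_mul_left _ _ hq]
  rfl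

/-- For l < n the last term is a quarter of the probability of `t` when each player leaks
independently with probability l/n. It absorbs the transcripts where W is too large for
`log_weightSum_le` to bound f. -/
theorem law_mixture_le [Fintype 𝒳] [Nonempty 𝒳] (π : Protocol n 𝒳) {c η : ℝ} {l : ℕ} (hln : l ≤ n)
    (hl : 0 < l) (hc : c ∈ Set.Ioo (0 : ℝ) 1) (hη : 0 < η) (hηc : (1 + η) * c < 1) (x : 𝒳)
    (t : List ℕ) (hgood : ∀ i, π.posterior (fixed l n hln) i t x ≤ c) :
    (n.choose l : ℝ)⁻¹ * ∑ S ∈ powersetCard l (univ : Finset (Fin n)), (π.law x S t).toReal ≤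
      ratioBound c η l * (π.law x ∅ t).toReal +
        (4 * (1 + (l : ℝ) / (n - l)) ^ n)⁻¹ *
          ∑ S : Finset (Fin n), ((l : ℝ) / (n - l)) ^ #S * (π.law x S t).toReal := by
  have hln' : (0 : ℝ) ≤ n - l := by rw [sub_nonneg]; exact_mod_cast hln
  set lam : ℝ := (l : ℝ) / (n - l) with hlam
  have hlam0 : 0 ≤ lam := by positivity
  have hM : 0 ≤ ratioBound c η l := by rw [ratioBound]; positivity
  have hlawnn : ∀ S, 0 ≤ (π.law x S t).toReal := fun S => ENNReal.toReal_nonneg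
  have hG : 0 ≤ (4 * (1 + lam) ^ n)⁻¹ * ∑ S : Finset (Fin n), lam ^ #S * (π.law x S t).toReal :=
    mul_nonneg (by positivity)
      (Finset.sum_nonneg fun S _ => mul_nonneg (by positivity) (hlawnn S))
  set F := ∑ S ∈ powersetCard l (univ : Finset (Fin n)), (π.law x S t).toReal with hFdef
  have hF0 : 0 ≤ F := Finset.sum_nonneg fun S _ => hlawnn S
  rcases hF0.eq_or_lt with hF | hF
  · rw [← hF, mul_zero]
    exact add_nonneg (mul_nonneg hM (hlawnn _)) hG
  obtain ⟨z, hz0, hq, hz⟩ := π.exists_law_eq_mul_prod (l := l) x t hF (fun i => by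
    have := hgood i
    rw [posterior_fixed, div_le_iff₀ hF] at this
    refine this.trans_lt ?_
    rw [← hFdef]
    nlinarith [hc.2])
  set q := (π.law x ∅ t).toReal with hqdef
  have hFz : F = q * weightSum l z := by
    rw [hFdef, weightSum, Finset.mul_sum]
    exact Finset.sum_congr rfl fun S _ => hz S
  have hfz : 0 < weightSum l z := by
    rw [hFz] at hF
    exact (pos_iff_pos_of_mul_pos hF).mp hq
  have hmarg : ∀ i, marginal l z i ≤ c := fun i =>
    (π.posterior_eq_marginal hln x t i hq.ne' hz) ▸ hgood i
  -- The posteriors sum to l and are at most c < 1. This excludes l = n, where `lam` would be a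
  -- division by zero.
  have hlt : l < n := by
    have h1 : (l : ℝ) ≤ n * c := by
      rw [← sum_marginal hfz]
      refine (Finset.sum_le_sum fun i _ => hmarg i).trans ?_
      simp
    have hl' : (0 : ℝ) < l := by exact_mod_cast hl
    have : (l : ℝ) < n := by
      have : (0 : ℝ) ≤ n := by positivity
      nlinarith [hc.2, hc.1]
    exact_mod_cast this
  have hnl : (0 : ℝ) < n - l := by rw [sub_pos]; exact_mod_cast hlt
  have hl' : (0 : ℝ) < l := by exact_mod_cast hl
  have hlampos : 0 < lam := by positivity
  set w : Fin n → ℝ := fun i => lam * z i with hw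
  have hw0 : ∀ i, 0 ≤ w i := fun i => mul_nonneg hlam0 (hz0 i)
  have hwf : weightSum l w = lam ^ l * weightSum l z := weightSum_smul lam z
  have hf : 0 < weightSum l w := by rw [hwf]; positivity
  have hbound := log_weightSum_le hc hη hηc hw0 hf fun i =>
    (marginal_smul hlampos.ne' z i).trans_le (hmarg i)
  set f := weightSum l w with hfdef
  set W := ∏ i, (1 + w i) with hWdef
  have hWpos : 0 < W := Finset.prod_pos fun i _ => by have := hw0 i; positivity
  have hGW : ∑ S : Finset (Fin n), lam ^ #S * (π.law x S t).toReal = q * W := by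
    rw [hWdef, Finset.prod_one_add, Finset.mul_sum]
    simp only [powerset_univ]
    refine Finset.sum_congr rfl fun S _ => ?_
    rw [hz S, hw, Finset.prod_mul_distrib, Finset.prod_const]
    ring
  rw [hGW]
  have hch : (0 : ℝ) < n.choose l := by exact_mod_cast Nat.choose_pos hln
  have hK := one_add_pow_le_choose hl hlt
  rw [← hlam] at hK
  have hE := exp_le_one_add_pow hlt
  rw [← hlam] at hE
  set P := (1 + lam) ^ n with hP
  have hPpos : 0 < P := by positivity
  set k := Real.exp 1 * l with hk
  have hkpos : 0 < k := by positivity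
  have hFf : (n.choose l : ℝ)⁻¹ * F = q * f * (n.choose l * lam ^ l)⁻¹ := by
    rw [hFz, hwf]; field_simp
  have hinv : ((n.choose l : ℝ) * lam ^ l)⁻¹ ≤ k * P⁻¹ := by
    rw [← div_eq_mul_inv, le_div_iff₀ hPpos, inv_mul_le_iff₀ (by positivity)]
    linarith
  have hFk : (n.choose l : ℝ)⁻¹ * F ≤ q * f * (k * P⁻¹) := by
    rw [hFf]; gcongr
  -- In the first case log W ≤ log(4k) + log f cancels one copy of log f and leaves η log f bounded.
  -- In the second, f is at most W/(4k).
  by_cases hcase : W ≤ 4 * k * f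
  · have hlogW : Real.log W ≤ Real.log (4 * k) + Real.log f := by
      rw [← Real.log_mul (by positivity) hf.ne']
      exact Real.log_le_log hWpos hcase
    have hlogf : Real.log f ≤
        Real.log (4 * k) / η + l * (-Real.log (1 - c) / c + η / (1 - c)) := by
      have : η * Real.log f ≤ η * (Real.log (4 * k) / η +
          l * (-Real.log (1 - c) / c + η / (1 - c))) := by
        have e : η * (Real.log (4 * k) / η) = Real.log (4 * k) := mul_div_cancel₀ _ hη.ne'
        rw [mul_add, e]
        linarith
      exact le_of_mul_le_mul_left this hη
    have hfle : f ≤ Real.exp (Real.log (4 * k) / η +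
        l * (-Real.log (1 - c) / c + η / (1 - c))) := by
      rw [← Real.exp_log hf]
      exact Real.exp_le_exp.mpr hlogf
    have hPinv : P⁻¹ ≤ Real.exp (-l) := by
      rw [Real.exp_neg]
      exact inv_anti₀ (Real.exp_pos _) hE
    calc (n.choose l : ℝ)⁻¹ * F ≤ q * f * (k * P⁻¹) := hFk
      _ ≤ q * Real.exp (Real.log (4 * k) / η + l * (-Real.log (1 - c) / c + η / (1 - c))) *
          (k * Real.exp (-l)) := by gcongr
      _ = ratioBound c η l * q := by rw [ratioBound]; ring
      _ ≤ _ := by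
        have : 0 ≤ (4 * P)⁻¹ * (q * W) := by positivity
        linarith
  · have h1 : (n.choose l : ℝ)⁻¹ * F ≤ (4 * P)⁻¹ * (q * W) := by
      refine hFk.trans ?_
      have : q * f * (k * P⁻¹) = (4 * P)⁻¹ * (q * (4 * k * f)) := by field_simp
      rw [this]
      have := (not_le.mp hcase).le
      gcongr
    have h2 : 0 ≤ ratioBound c η l * q := by positivity
    linarith

/-- The pointwise bound is summed over the good transcripts; the independent-leaker mixture
contributes at most 1/4. -/
theorem one_sub_le_ratioBound_mul [Fintype 𝒳] [Nonempty 𝒳] (π : Protocol n 𝒳) {c η ε : ℝ} {l : ℕ}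
    (hln : l ≤ n) (hl : 0 < l) (hc : c ∈ Set.Ioo (0 : ℝ) 1) (hη : 0 < η)
    (hηc : (1 + η) * c < 1) (D : List ℕ → 𝒳) (hπ : π.IsRisky D (fixed l n hln) c ε) (x : 𝒳) :
    1 - ε ≤ ratioBound c η l *
      prob (π.law x ∅) {t | (∀ i, π.posterior (fixed l n hln) i t x ≤ c) ∧ D t = x} + 1 / 4 := by
  set E : Set (List ℕ) := {t | (∀ i, π.posterior (fixed l n hln) i t x ≤ c) ∧ D t = x} with hE
  have h := hπ x
  rw [π.condProb_secret_fixed hln x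
    (fun t => (∀ i, π.posterior (fixed l n hln) i t x ≤ c) ∧ D t = x)] at h
  refine h.trans ?_
  have hln' : (0 : ℝ) ≤ n - l := by rw [sub_nonneg]; exact_mod_cast hln
  have hlam0 : 0 ≤ (l : ℝ) / (n - l) := by positivity
  have hsum := hasSum_le (fun t => ?_)
    ((hasSum_sum fun S (_ : S ∈ powersetCard l (univ : Finset (Fin n))) =>
      hasSum_prob (π.law x S) E).mul_left (n.choose l : ℝ)⁻¹)
    (((hasSum_prob (π.law x ∅) E).mul_left (ratioBound c η l)).add
      ((hasSum_sum fun S (_ : S ∈ (univ : Finset (Finset (Fin n)))) =>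
        (hasSum_prob (π.law x S) E).mul_left (((l : ℝ) / (n - l)) ^ #S)).mul_left
          (4 * (1 + (l : ℝ) / (n - l)) ^ n)⁻¹))
  · refine hsum.trans (add_le_add le_rfl ?_)
    have hone : ∑ S : Finset (Fin n), ((l : ℝ) / (n - l)) ^ #S = (1 + (l : ℝ) / (n - l)) ^ n := by
      have := Finset.prod_one_add (s := (univ : Finset (Fin n))) (f := fun _ => (l : ℝ) / (n - l))
      simp only [prod_const, card_univ, Fintype.card_fin, powerset_univ] at this
      exact this.symm
    calc (4 * (1 + (l : ℝ) / (n - l)) ^ n)⁻¹ *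
          ∑ S : Finset (Fin n), ((l : ℝ) / (n - l)) ^ #S * prob (π.law x S) E
        ≤ (4 * (1 + (l : ℝ) / (n - l)) ^ n)⁻¹ *
          ∑ S : Finset (Fin n), ((l : ℝ) / (n - l)) ^ #S * 1 := by
          gcongr
          exact prob_le_one _ _
      _ = 1 / 4 := by
          simp only [mul_one]
          rw [hone]
          have : (1 + (l : ℝ) / (n - l)) ^ n ≠ 0 := by positivity
          field_simp
  · by_cases ht : t ∈ E
    · simp only [ht, Set.indicator_of_mem]
      exact π.law_mixture_le hln hl hc hη hηc x t ht.1
    · simp [ht]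

theorem card_secrets_le [Fintype 𝒳] [Nonempty 𝒳] (π : Protocol n 𝒳) {c η : ℝ} {l : ℕ}
    (hln : l ≤ n) (hl : 0 < l) (hc : c ∈ Set.Ioo (0 : ℝ) 1) (hη : 0 < η)
    (hηc : (1 + η) * c < 1) (D : List ℕ → 𝒳) (hπ : π.IsRisky D (fixed l n hln) c (1 / 4)) :
    (Fintype.card 𝒳 : ℝ) ≤ 2 * ratioBound c η l := by
  have h := Finset.sum_le_sum fun x (_ : x ∈ univ) =>
    π.one_sub_le_ratioBound_mul hln hl hc hη hηc D hπ x
  simp only [sum_const, card_univ, nsmul_eq_mul, Finset.sum_add_distrib] at h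
  rw [← Finset.mul_sum] at h
  obtain ⟨x₀⟩ := ‹Nonempty 𝒳›
  have hfib := sum_prob_le_one_of_fibers (π.law x₀ ∅) D
    (fun x => {t | (∀ i, π.posterior (fixed l n hln) i t x ≤ c) ∧ D t = x})
    (fun x t ht => ht.2)
  simp_rw [π.law_empty_eq _ x₀] at h
  have hM : 0 ≤ ratioBound c η l := by rw [ratioBound]; positivity
  have := mul_le_mul_of_nonneg_left hfib hM
  linarith

end Protocol

theorem RiskilyAchievable.le {c R : ℝ} (hc : c ∈ Set.Ioo (0 : ℝ) 1) (hR : RiskilyAchievable c R) :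
    R ≤ -Real.logb 2 (1 - c) / c - Real.logb 2 (Real.exp 1) := by
  by_contra! hlt
  have hlog2 : 0 < Real.log 2 := Real.log_pos one_lt_two
  have h1c : 0 < 1 - c := by linarith [hc.2]
  set g := -Real.log (1 - c) / c with hg
  obtain ⟨γ, hγ, hγR⟩ : ∃ γ : ℝ, 0 < γ ∧ R * Real.log 2 = g - 1 + γ := by
    refine ⟨R * Real.log 2 - (g - 1), ?_, by ring⟩
    rw [Real.logb, Real.logb, Real.log_exp] at hlt
    have := mul_lt_mul_of_pos_right hlt hlog2
    have e : (-(Real.log (1 - c) / Real.log 2) / c - 1 / Real.log 2) * Real.log 2 = g - 1 := by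
      rw [hg]; field_simp
    rw [e] at this
    linarith
  -- Half of the excess γ pays for η/(1-c). As η is fixed before l, the other half eventually beats
  -- the terms logarithmic in l.
  obtain ⟨η, hη, hηc, hηγ⟩ : ∃ η : ℝ, 0 < η ∧ (1 + η) * c < 1 ∧ η / (1 - c) ≤ γ / 2 := by
    refine ⟨min ((1 - c) / 2) (γ / 2 * (1 - c)), by positivity, ?_, ?_⟩
    · have := min_le_left ((1 - c) / 2) (γ / 2 * (1 - c))
      nlinarith [hc.1, hc.2]
    · rw [div_le_iff₀ h1c]
      exact min_le_right _ _
  have hev : ∀ᶠ l : ℕ in Filter.atTop,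
      (1 + 1 / η) * Real.log (4 * (Real.exp 1 * l)) < l * (γ / 2) := by
    have h1 : Filter.Tendsto (fun l : ℕ => Real.log (4 * (Real.exp 1 * l)) /
        (4 * (Real.exp 1 * l))) Filter.atTop (nhds 0) := by
      have hlim : Filter.Tendsto (fun l : ℕ => 4 * (Real.exp 1 * (l : ℝ))) Filter.atTop
          Filter.atTop :=
        (tendsto_natCast_atTop_atTop.const_mul_atTop (Real.exp_pos 1)).const_mul_atTop four_pos
      exact Real.isLittleO_log_id_atTop.tendsto_div_nhds_zero.comp hlim
    have h2 := h1.eventually (gt_mem_nhds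
      (show 0 < γ / 2 / ((1 + 1 / η) * (4 * Real.exp 1)) by positivity))
    filter_upwards [h2, Filter.eventually_gt_atTop 0] with l hl hl0
    have hl0' : (0 : ℝ) < l := by exact_mod_cast hl0
    rw [div_lt_div_iff₀ (by positivity) (by positivity)] at hl
    have : (0 : ℝ) < 4 * Real.exp 1 := by positivity
    refine lt_of_mul_lt_mul_right ?_ this.le
    linarith
  obtain ⟨l₀, hl₀⟩ := Filter.eventually_atTop.mp hev
  obtain ⟨l, hl, n, hln, π, D, hπ⟩ := hR (1 / 4) (by norm_num) (max l₀ 1)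
  have hlpos : 0 < l := lt_of_lt_of_le one_pos ((le_max_right _ _).trans hl)
  have hl' : (0 : ℝ) < l := by exact_mod_cast hlpos
  have hcard := π.card_secrets_le hln hlpos hc hη hηc D hπ
  have hcontra := hl₀ l ((le_max_left _ _).trans hl)
  rw [Fintype.card_fin] at hcard
  push_cast at hcard
  have hlow : Real.exp (l * (g - 1 + γ)) ≤ (2 : ℝ) ^ ⌈(l : ℝ) * R⌉₊ := by
    rw [← hγR, ← Real.rpow_natCast, Real.rpow_def_of_pos two_pos]
    refine Real.exp_le_exp.mpr ?_
    have := Nat.le_ceil ((l : ℝ) * R)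
    calc (l : ℝ) * (R * Real.log 2) = Real.log 2 * (l * R) := by ring
      _ ≤ _ := by gcongr
  have hk : (0 : ℝ) < Real.exp 1 * l := by positivity
  have hup : 2 * ratioBound c η l ≤ Real.exp ((1 + 1 / η) * Real.log (4 * (Real.exp 1 * l)) +
      l * (g - 1 + γ / 2)) := by
    rw [ratioBound, ← hg]
    calc 2 * (Real.exp (Real.log (4 * (Real.exp 1 * l)) / η + l * (g + η / (1 - c))) *
          (Real.exp 1 * l * Real.exp (-l)))
        ≤ 4 * (Real.exp (Real.log (4 * (Real.exp 1 * l)) / η + l * (g + γ / 2)) *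
          (Real.exp 1 * l * Real.exp (-l))) := by
          gcongr
          norm_num
      _ = Real.exp (Real.log (4 * (Real.exp 1 * l))) *
          (Real.exp (Real.log (4 * (Real.exp 1 * l)) / η + l * (g + γ / 2)) *
            Real.exp (-l)) := by
          rw [Real.exp_log (by positivity)]; ring
      _ = _ := by
          rw [← Real.exp_add, ← Real.exp_add]
          congr 1
          ring
  have := Real.exp_le_exp.mp (hlow.trans (hcard.trans hup))
  linarith

/-! ### Achievability: construction of the messages. -/

section Messages

variable {𝒳 : Type*}

/-- The messages of one step: an ignorant player draws from `ignorant`, a leaker with secret `x`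
draws from `leaking x`, which is `ignorant` conditioned on avoiding the set `kill x`. Under each
of these distributions, other secrets are hit with probability `1 / (N + 1)`. -/
structure SieveMessages (𝒳 : Type*) (N : ℕ) where
  ignorant : PMF ℕ
  leaking : 𝒳 → PMF ℕ
  kill : 𝒳 → Set ℕ
  leaking_of_mem : ∀ x, ∀ m ∈ kill x, leaking x m = 0
  leaking_of_notMem : ∀ x, ∀ m ∉ kill x,
    (leaking x m).toReal = (1 + 1 / (N : ℝ)) * (ignorant m).toReal
  prob_ignorant : ∀ x, prob ignorant (kill x) = 1 / (N + 1 : ℝ)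
  prob_leaking : ∀ x y, x ≠ y → prob (leaking x) (kill y) = 1 / (N + 1 : ℝ)

/-- A condition that ignores coordinate `x` leaves it uniform over its N + 1 values. -/
theorem card_filter_apply_eq_zero [Fintype 𝒳] [DecidableEq 𝒳] (N : ℕ) (x : 𝒳)
    (A : (𝒳 → Fin (N + 1)) → Prop) [DecidablePred A]
    (hA : ∀ y a, A (Function.update y x a) ↔ A y) :
    #{y : 𝒳 → Fin (N + 1) | A y ∧ y x = 0} * (N + 1) = #{y : 𝒳 → Fin (N + 1) | A y} := by
  have h1 : #{y : 𝒳 → Fin (N + 1) | A y} =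
      ∑ a : Fin (N + 1), #{y : 𝒳 → Fin (N + 1) | A y ∧ y x = a} := by
    rw [Finset.card_eq_sum_card_fiberwise (f := fun y => y x) (t := univ) (by simp)]
    simp only [Finset.filter_filter]
  have h2 : ∀ a : Fin (N + 1), #{y : 𝒳 → Fin (N + 1) | A y ∧ y x = a} =
      #{y : 𝒳 → Fin (N + 1) | A y ∧ y x = 0} := by
    intro a
    refine Finset.card_nbij' (fun y => Function.update y x 0) (fun y => Function.update y x a)
      ?_ ?_ ?_ ?_
    · intro y hy; simp_all
    · intro y hy; simp_all
    · intro y hy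
      simp only [coe_filter, mem_univ, true_and, Set.mem_ofPred_eq] at hy
      simp [← hy.2]
    · intro y hy
      simp only [coe_filter, mem_univ, true_and, Set.mem_ofPred_eq] at hy
      simp [← hy.2]
  rw [h1, Finset.sum_congr rfl fun a _ => h2 a]
  simp [mul_comm]

theorem prob_map {α β : Type*} (p : PMF α) (f : α → β) (E : Set β) :
    prob (p.map f) E = prob p (f ⁻¹' E) := by
  rw [prob, prob, PMF.toOuterMeasure_map_apply]

theorem map_apply_of_injective {α β : Type*} (p : PMF α) {f : α → β} (hf : f.Injective) (a : α) :
    (p.map f) (f a) = p a := by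
  rw [← PMF.toOuterMeasure_apply_singleton, PMF.toOuterMeasure_map_apply,
    ← PMF.toOuterMeasure_apply_singleton]
  congr 1
  ext b
  simp [hf.eq_iff]

theorem map_apply_of_notMem_range {α β : Type*} (p : PMF α) {f : α → β} {b : β}
    (hb : b ∉ Set.range f) : (p.map f) b = 0 := by
  rw [PMF.apply_eq_zero_iff, PMF.mem_support_map_iff]
  rintro ⟨a, -, ha⟩
  exact hb ⟨a, ha⟩

/-- A message codes a uniformly random function from 𝒳 to `Fin (N + 1)` and kills the secrets where
it vanishes. Independence of the coordinates gives both kill probabilities. -/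
theorem nonempty_sieveMessages (𝒳 : Type*) [Fintype 𝒳] {N : ℕ} (hN : 0 < N) :
    Nonempty (SieveMessages 𝒳 N) := by
  classical
  let enc : (𝒳 → Fin (N + 1)) → ℕ := fun y => (Fintype.equivFin _ y).val
  have henc : enc.Injective := Fin.val_injective.comp (Equiv.injective _)
  let T : 𝒳 → Finset (𝒳 → Fin (N + 1)) := fun x => {y | y x ≠ 0}
  have hne : ∀ x, (T x).Nonempty := fun x =>
    ⟨fun _ => Fin.last N, mem_filter.mpr ⟨mem_univ _, fun h => hN.ne' (congrArg Fin.val h)⟩⟩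
  have hN' : (0 : ℝ) < N := by exact_mod_cast hN
  have hzero : ∀ x, (#{y : 𝒳 → Fin (N + 1) | y x = 0} : ℝ) * (N + 1) =
      Fintype.card (𝒳 → Fin (N + 1)) := by
    intro x
    have := card_filter_apply_eq_zero N x (fun _ => True) (by simp)
    simp only [true_and, filter_true, card_univ] at this
    exact_mod_cast this
  have hT : ∀ x, (#(T x) : ℝ) * (N + 1) = N * Fintype.card (𝒳 → Fin (N + 1)) := by
    intro x
    have h := Finset.card_filter_add_card_filter_not (s := (univ : Finset (𝒳 → Fin (N + 1))))
      (fun y => y x = 0)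
    rw [card_univ] at h
    have h' : (#{y : 𝒳 → Fin (N + 1) | y x = 0} : ℝ) + #(T x) =
      Fintype.card (𝒳 → Fin (N + 1)) := by exact_mod_cast h
    have := hzero x
    nlinarith
  have hcard : (0 : ℝ) < Fintype.card (𝒳 → Fin (N + 1)) := by
    exact_mod_cast Fintype.card_pos
  have hTpos : ∀ x, (0 : ℝ) < #(T x) := fun x => by exact_mod_cast (hne x).card_pos
  have hpre : ∀ x, enc ⁻¹' (enc '' {y | y x = 0}) = {y | y x = 0} := fun x =>
    Set.preimage_image_eq _ henc
  refine ⟨⟨(PMF.uniformOfFintype (𝒳 → Fin (N + 1))).map enc,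
    fun x => (PMF.uniformOfFinset (T x) (hne x)).map enc, fun x => enc '' {y | y x = 0},
    ?_, ?_, ?_, ?_⟩⟩
  · rintro x _ ⟨y, hy, rfl⟩
    rw [map_apply_of_injective _ henc, PMF.uniformOfFinset_apply_of_notMem]
    simpa [T] using hy
  · intro x m hm
    by_cases hr : m ∈ Set.range enc
    · obtain ⟨y, rfl⟩ := hr
      have hy : y ∈ T x := by
        simp only [T, mem_filter, mem_univ, true_and]
        exact fun h => hm ⟨y, h, rfl⟩
      rw [map_apply_of_injective _ henc, map_apply_of_injective _ henc,
        PMF.uniformOfFinset_apply_of_mem _ hy, PMF.uniformOfFintype_apply]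
      simp only [ENNReal.toReal_inv, ENNReal.toReal_natCast]
      have := hT x
      have := hTpos x
      field_simp
      linarith
    · rw [map_apply_of_notMem_range _ hr, map_apply_of_notMem_range _ hr]
      simp
  · intro x
    rw [prob_map, hpre, prob, PMF.toOuterMeasure_uniformOfFintype_apply, ENNReal.toReal_div,
      ENNReal.toReal_natCast, ENNReal.toReal_natCast, div_eq_div_iff hcard.ne' (by positivity),
      one_mul, ← hzero x]
    congr 2
    rw [Fintype.card_subtype]
    rfl
  · intro x x' hx
    rw [prob_map, hpre, prob, PMF.toOuterMeasure_uniformOfFinset_apply, ENNReal.toReal_div,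
      ENNReal.toReal_natCast, ENNReal.toReal_natCast,
      div_eq_div_iff (hTpos x).ne' (by positivity), one_mul]
    have := card_filter_apply_eq_zero N x' (fun y => y x ≠ 0)
      (fun y a => by rw [Function.update_of_ne hx])
    have h2 : Finset.filter (· ∈ {y : 𝒳 → Fin (N + 1) | y x' = 0}) (T x) =
        ({y | y x ≠ 0 ∧ y x' = 0} : Finset (𝒳 → Fin (N + 1))) := by
      ext y; simp [T]
    have h3 : (#({y | y x ≠ 0 ∧ y x' = 0} : Finset (𝒳 → Fin (N + 1))) : ℝ) * (N + 1) = #(T x) := by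
      exact_mod_cast this
    rw [← h3, ← h2]
    congr!

end Messages

/-! ### Achievability: balanced weights bound every marginal. -/

section Marginals

variable {n l : ℕ}

/-- Transposing i and j matches the sets containing i with those containing j, and changes a product
at most by exchanging `w i` for `w j`. -/
theorem sum_mem_le_mul_sum_mem {w : Fin n → ℝ} {b : ℝ} (hw : ∀ i, 0 ≤ w i) (hb : 1 ≤ b)
    {i j : Fin n} (hij : w i ≤ b * w j) :
    ∑ S ∈ powersetCard l (univ : Finset (Fin n)) with i ∈ S, ∏ k ∈ S, w k ≤
      b * ∑ S ∈ powersetCard l (univ : Finset (Fin n)) with j ∈ S, ∏ k ∈ S, w k := by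
  have hbij : ∑ S ∈ powersetCard l (univ : Finset (Fin n)) with j ∈ S, ∏ k ∈ S, w k =
      ∑ S ∈ powersetCard l (univ : Finset (Fin n)) with i ∈ S,
        ∏ k ∈ S, w (Equiv.swap i j k) := by
    refine Finset.sum_nbij' (fun S => S.map (Equiv.swap i j).toEmbedding)
      (fun S => S.map (Equiv.swap i j).toEmbedding) ?_ ?_ ?_ ?_ ?_
    · intro S hS
      simp only [mem_filter, mem_powersetCard, subset_univ, true_and, card_map] at hS ⊢
      exact ⟨hS.1, by simpa [Finset.mem_map_equiv] using hS.2⟩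
    · intro S hS
      simp only [mem_filter, mem_powersetCard, subset_univ, true_and, card_map] at hS ⊢
      exact ⟨hS.1, by simpa [Finset.mem_map_equiv] using hS.2⟩
    · intro S _
      ext k; simp [Finset.mem_map_equiv]
    · intro S _
      ext k; simp [Finset.mem_map_equiv]
    · intro S _
      simp
  rw [hbij, Finset.mul_sum]
  refine Finset.sum_le_sum fun S hS => ?_
  have hi : i ∈ S := (mem_filter.mp hS).2
  have hprod : 0 ≤ ∏ k ∈ S, w k := Finset.prod_nonneg fun _ _ => hw _
  by_cases hj : j ∈ S
  · rw [Equiv.Perm.prod_comp (Equiv.swap i j) S w]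
    · nlinarith
    · intro k hk
      by_contra hkS
      have hki : k ≠ i := fun h => hkS (by simpa [h] using hi)
      have hkj : k ≠ j := fun h => hkS (by simpa [h] using hj)
      exact hk (Equiv.swap_apply_of_ne_of_ne hki hkj)
  · rw [← Finset.mul_prod_erase S w hi, ← Finset.mul_prod_erase S _ hi, Equiv.swap_apply_left]
    have e : ∏ k ∈ S.erase i, w (Equiv.swap i j k) = ∏ k ∈ S.erase i, w k := by
      refine Finset.prod_congr rfl fun k hk => ?_
      rw [Equiv.swap_apply_of_ne_of_ne (Finset.ne_of_mem_erase hk)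
        fun h : k = j => hj (h ▸ Finset.mem_of_mem_erase hk)]
    rw [e, ← mul_assoc]
    exact mul_le_mul_of_nonneg_right hij (Finset.prod_nonneg fun _ _ => hw _)

/-- If all nonzero weights agree up to a factor `b`, no player is much more suspicious than the
others. -/
theorem marginal_le_of_balanced {w : Fin n → ℝ} {a b c : ℝ} (ha : 0 < a) (hb : 1 ≤ b)
    (hw : ∀ i, w i = 0 ∨ a ≤ w i ∧ w i ≤ b * a) (hf : 0 < weightSum l w) (hc : 0 ≤ c)
    {m : ℕ} (hm : m ≤ #{i | w i ≠ 0}) (hm0 : 0 < m) (hbl : b * l ≤ c * m) (i : Fin n) :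
    marginal l w i ≤ c := by
  have hw0 : ∀ i, 0 ≤ w i := fun i => by
    rcases hw i with h | h
    · exact h.ge
    · exact ha.le.trans h.1
  rcases hw i with hi | hi
  · rw [marginal_eq_zero hi]; exact hc
  have hpair : ∀ j ∈ ({i | w i ≠ 0} : Finset (Fin n)), marginal l w i ≤ b * marginal l w j := by
    intro j hj
    have hj' := (hw j).resolve_left (mem_filter.mp hj).2
    rw [marginal, marginal, ← mul_div_assoc]
    have : w i ≤ b * w j := hi.2.trans (by gcongr; exact hj'.1)
    have := sum_mem_le_mul_sum_mem (l := l) hw0 hb this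
    gcongr
  have h := Finset.sum_le_sum hpair
  rw [Finset.sum_const, nsmul_eq_mul, ← Finset.mul_sum] at h
  have hle : ∑ j ∈ ({i | w i ≠ 0} : Finset (Fin n)), marginal l w j ≤ l := by
    rw [← sum_marginal hf]
    exact Finset.sum_le_sum_of_subset_of_nonneg (filter_subset _ _)
      fun j _ _ => marginal_nonneg hw0 j
  have hm' : (m : ℝ) ≤ #{i | w i ≠ 0} := by exact_mod_cast hm
  have hmr : (0 : ℝ) < m := by exact_mod_cast hm0
  have hmi := marginal_nonneg (l := l) hw0 i
  have : marginal l w i * m ≤ c * m := by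
    calc marginal l w i * m ≤ #{i | w i ≠ 0} * marginal l w i := by
          rw [mul_comm]; gcongr
      _ ≤ b * ∑ j ∈ ({i | w i ≠ 0} : Finset (Fin n)), marginal l w j := h
      _ ≤ b * l := by gcongr
      _ ≤ c * m := hbl
  exact le_of_mul_le_mul_right this hmr

end Marginals

/-! ### Achievability: the sieve protocol, its safety and its error probability. -/

section Sieve

variable {n N : ℕ} [NeZero n] {𝒳 : Type*}

/-- The number of messages among the first `k` that player `i` sends, in round-robin order. -/
def turns (i : Fin n) (k : ℕ) : ℕ := Nat.count (fun j => Fin.ofNat n j = i) k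

theorem turns_succ (i : Fin n) (k : ℕ) :
    turns i (k + 1) = turns i k + if Fin.ofNat n k = i then 1 else 0 :=
  Nat.count_succ _ _

theorem turns_eq (i : Fin n) (k : ℕ) :
    turns i k = k / n + if (i : ℕ) < k % n then 1 else 0 := by
  have hn : 0 < n := NeZero.pos n
  have h := Nat.count_modEq_card k hn i
  rw [Nat.mod_eq_of_lt i.isLt] at h
  rw [← h, turns]
  congr! 2 with j
  rw [Fin.ext_iff, Fin.val_ofNat, Nat.ModEq, Nat.mod_eq_of_lt i.isLt]

theorem turns_mul (i : Fin n) (ρ : ℕ) : turns i (ρ * n) = ρ := by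
  simp [turns_eq, Nat.mul_div_cancel _ (NeZero.pos n)]

theorem turns_mono (i : Fin n) : Monotone (turns i) := Nat.count_monotone _

namespace SieveMessages

open Classical in
/-- The players none of whose messages excludes the secret `x`. -/
noncomputable def survivors (M : SieveMessages 𝒳 N) (n : ℕ) [NeZero n] (x : 𝒳) (t : List ℕ) :
    Finset (Fin n) :=
  {i | ∀ k m, t[k]? = some m → Fin.ofNat n k = i → m ∉ M.kill x}

variable (M : SieveMessages 𝒳 N)

theorem survivors_nil (x : 𝒳) : M.survivors n x [] = univ := by
  simp [survivors]

theorem mem_survivors_concat (x : 𝒳) (t : List ℕ) (m : ℕ) (i : Fin n) :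
    i ∈ M.survivors n x (t ++ [m]) ↔
      i ∈ M.survivors n x t ∧ (Fin.ofNat n t.length = i → m ∉ M.kill x) := by
  simp only [survivors, mem_filter, mem_univ, true_and]
  constructor
  · refine fun h => ⟨fun k m' hk => h k m' ?_, h t.length m (by simp)⟩
    rw [List.getElem?_append_left]
    · exact hk
    · exact (List.getElem?_eq_some_iff.mp hk).1
  · rintro ⟨h1, h2⟩ k m' hk hki
    rw [List.getElem?_append] at hk
    split at hk
    · exact h1 k m' hk hki
    · rename_i hlt
      rw [List.getElem?_singleton] at hk
      split at hk
      · rename_i h0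
        have hkl : k = t.length := by omega
        rw [← Option.some.inj hk]
        exact h2 (hkl ▸ hki)
      · simp at hk

theorem survivors_concat_subset (x : 𝒳) (t : List ℕ) (m : ℕ) :
    M.survivors n x (t ++ [m]) ⊆ M.survivors n x t := fun i hi =>
  ((M.mem_survivors_concat x t m i).mp hi).1

/-- A message can eliminate only its sender. Hence, when leaking stops, still at least `thr - 1`
players survive. -/
theorem card_survivors_le_concat (x : 𝒳) (t : List ℕ) (m : ℕ) :
    #(M.survivors n x t) - 1 ≤ #(M.survivors n x (t ++ [m])) := by
  refine Finset.pred_card_le_card_erase.trans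
    (Finset.card_le_card (s := (M.survivors n x t).erase (Fin.ofNat n t.length)) fun i hi => ?_)
  rw [mem_survivors_concat]
  exact ⟨Finset.mem_of_mem_erase hi, fun h => absurd h.symm (Finset.ne_of_mem_erase hi)⟩

open Classical in
/-- For `ρ` rounds, all players speak in turn. The leakers stop leaking as soon as fewer than
`thr` players survive for the secret. -/
noncomputable def protocol (n : ℕ) [NeZero n] (ρ thr : ℕ) : Protocol n 𝒳 where
  next t := if t.length < ρ * n then some (Fin.ofNat n t.length) else none
  ignorant _ := M.ignorant
  leaking t x := if thr ≤ #(M.survivors n x t) then M.leaking x else M.ignorant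
  length := ρ * n
  terminates _ ht := if_neg (not_lt.mpr ht)

variable {ρ thr : ℕ}

theorem next_eq_some {t : List ℕ} {i : Fin n} (h : (M.protocol n ρ thr).next t = some i) :
    t.length < ρ * n ∧ Fin.ofNat n t.length = i := by
  simp only [protocol] at h
  split at h
  · exact ⟨‹_›, Option.some.inj h⟩
  · simp at h

theorem length_of_law_ne_zero {x : 𝒳} {S : Finset (Fin n)} {t : List ℕ}
    (h : (M.protocol n ρ thr).law x S t ≠ 0) : t.length = ρ * n := by
  obtain ⟨s, hs, hlen⟩ := Protocol.exists_append_of_run_ne_zero _ _ _ _ _ _ h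
  have hnone := Protocol.next_eq_none_of_run_ne_zero _ _ _ _ _ _ (by simp) h
  have h1 : t.length ≤ ρ * n := by
    rw [List.nil_append] at hs
    exact hs ▸ hlen
  simp only [protocol] at hnone
  split at hnone
  · simp at hnone
  · omega

/-- The likelihood factors over the leakers, with weights that are balanced among at least
`thr - 1` players. -/
theorem exists_balanced_weights (hthr : thr ≤ n) (hN : 0 < N) (x : 𝒳) (t : List ℕ)
    (ht : t.length ≤ ρ * n) :
    ∃ (κ : ℝ) (w : Fin n → ℝ),
      (∀ S : Finset (Fin n), (M.protocol n ρ thr).likelihood x (fun i => decide (i ∈ S)) [] t =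
        κ * ∏ i ∈ S, w i) ∧
      ((∀ i, w i = if i ∈ M.survivors n x t then (1 + 1 / (N : ℝ)) ^ turns i t.length else 0) ∧
          thr ≤ #(M.survivors n x t) ∨
        (∃ a : ℝ, 0 < a ∧ (∀ i, w i = 0 ∨ a ≤ w i ∧ w i ≤ (1 + 1 / (N : ℝ)) * a) ∧
          thr - 1 ≤ #{i | w i ≠ 0}) ∧ #(M.survivors n x t) < thr) := by
  induction t using List.reverseRecOn with
  | nil =>
    refine ⟨1, fun _ => 1, fun S => by simp [Protocol.likelihood], Or.inl ⟨fun i => ?_, ?_⟩⟩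
    · simp [survivors_nil, turns]
    · simpa [survivors_nil] using hthr
  | append_singleton t m ih =>
    rw [List.length_append, List.length_singleton] at ht ⊢
    obtain ⟨κ, w, hlik, hw⟩ := ih (by omega)
    have hnext : (M.protocol n ρ thr).next t = some (Fin.ofNat n t.length) := by
      simp only [protocol]
      exact if_pos (by omega)
    set i₀ : Fin n := Fin.ofNat n t.length with hi₀
    rcases hw with ⟨hw, hcard⟩ | ⟨hbal, hcard⟩
    · classical
      have hleak : (M.protocol n ρ thr).leaking t x = M.leaking x := by
        simp only [protocol]; exact if_pos hcard
      set r : ℝ := if m ∈ M.kill x then 0 else 1 + 1 / (N : ℝ) with hr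
      have hqr : (M.leaking x m).toReal = (M.ignorant m).toReal * r := by
        rw [hr]
        split
        · rename_i hm
          rw [M.leaking_of_mem x m hm]; simp
        · rename_i hm
          rw [M.leaking_of_notMem x m hm, mul_comm]
      refine ⟨κ * (M.ignorant m).toReal, fun i => w i * if i = i₀ then r else 1, fun S => ?_, ?_⟩
      · rw [Protocol.likelihood_concat, hlik, List.nil_append, Protocol.messageProb, hnext,
          Finset.prod_mul_distrib, Finset.prod_ite_eq' S i₀]
        simp only [hleak, decide_eq_true_eq]
        split
        · rw [hqr]; ring
        · simp only [protocol]; ring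
      · have hw' : ∀ i, (w i * if i = i₀ then r else 1) =
            if i ∈ M.survivors n x (t ++ [m]) then (1 + 1 / (N : ℝ)) ^ turns i (t.length + 1)
              else 0 := by
          intro i
          rw [hw i, turns_succ, ← hi₀]
          simp only [mem_survivors_concat, ← hi₀]
          by_cases hi : i = i₀
          · subst hi
            by_cases hs : i₀ ∈ M.survivors n x t <;> by_cases hm : m ∈ M.kill x <;>
              simp [hs, hm, hr, pow_succ]
          · have hi' : i₀ ≠ i := fun h => hi h.symm
            by_cases hs : i ∈ M.survivors n x t <;> simp [hs, hi, hi']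
        by_cases hthr' : thr ≤ #(M.survivors n x (t ++ [m]))
        · exact Or.inl ⟨hw', hthr'⟩
        -- Leaking stops here, possibly within a round: survivors have spoken equally often up to
        -- one turn, so their weights agree up to the factor 1 + 1/N.
        · refine Or.inr ⟨⟨(1 + 1 / (N : ℝ)) ^ ((t.length + 1) / n), by positivity,
            fun i => ?_, ?_⟩, not_le.mp hthr'⟩
          · beta_reduce
            rw [hw' i]
            split
            · right
              have h1 : (1 : ℝ) ≤ 1 + 1 / (N : ℝ) := le_add_of_nonneg_right (by positivity)
              rw [turns_eq, ← pow_succ']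
              constructor
              · exact pow_le_pow_right₀ h1 (by omega)
              · refine pow_le_pow_right₀ h1 ?_
                split <;> omega
            · exact Or.inl rfl
          · refine (Nat.sub_le_sub_right hcard 1).trans
              ((M.card_survivors_le_concat x t m).trans (Finset.card_le_card fun i hi => ?_))
            simp only [mem_filter, mem_univ, true_and]
            rw [hw' i, if_pos hi]
            positivity
    -- Once leaking has stopped, messages carry no information and the weights are frozen.
    · have hleak : (M.protocol n ρ thr).leaking t x = M.ignorant := by
        simp only [protocol]; exact if_neg (not_le.mpr hcard)
      refine ⟨κ * (M.ignorant m).toReal, w, fun S => ?_, Or.inr ⟨hbal, ?_⟩⟩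
      · rw [Protocol.likelihood_concat, hlik, List.nil_append, Protocol.messageProb, hnext]
        simp only [hleak]
        simp only [protocol, ite_self]
        ring
      · exact (Finset.card_le_card (M.survivors_concat_subset x t m)).trans_lt hcard

theorem posterior_le [Fintype 𝒳] [Nonempty 𝒳] {c : ℝ} {l : ℕ} (hln : l ≤ n) (hthr : thr ≤ n)
    (hthr1 : 1 < thr) (hN : 0 < N) (hc : 0 ≤ c)
    (hbl : (1 + 1 / (N : ℝ)) * l ≤ c * (thr - 1 : ℕ)) (x : 𝒳) (t : List ℕ)
    (hpos : 0 < ∑ S ∈ powersetCard l (univ : Finset (Fin n)),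
      ((M.protocol n ρ thr).law x S t).toReal) (i : Fin n) :
    (M.protocol n ρ thr).posterior (fixed l n hln) i t x ≤ c := by
  rcases (M.protocol n ρ thr).law_eq_likelihood_or_zero t with h | h
  swap
  · simp [h] at hpos
  have hlen : t.length = ρ * n := by
    obtain ⟨S, -, hS⟩ := Finset.exists_ne_zero_of_sum_ne_zero hpos.ne'
    exact M.length_of_law_ne_zero (x := x) (S := S) (thr := thr) fun h0 => hS (by rw [h0]; rfl)
  obtain ⟨κ, w, hlik, hw⟩ := M.exists_balanced_weights (ρ := ρ) hthr hN x t hlen.le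
  have hz : ∀ S, ((M.protocol n ρ thr).law x S t).toReal = κ * ∏ i ∈ S, w i := fun S =>
    (h x S).trans (hlik S)
  have hβ : (1 : ℝ) ≤ 1 + 1 / (N : ℝ) := le_add_of_nonneg_right (by positivity)
  obtain ⟨a, ha, hbal, hcard⟩ : ∃ a : ℝ, 0 < a ∧
      (∀ i, w i = 0 ∨ a ≤ w i ∧ w i ≤ (1 + 1 / (N : ℝ)) * a) ∧ thr - 1 ≤ #{i | w i ≠ 0} := by
    rcases hw with ⟨hw, hcard⟩ | ⟨hbal, -⟩
    -- After complete rounds all survivors have the same weight.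
    · refine ⟨(1 + 1 / (N : ℝ)) ^ ρ, by positivity, fun i => ?_, ?_⟩
      · rw [hw i, hlen, turns_mul]
        split
        · exact Or.inr ⟨le_rfl, le_mul_of_one_le_left (by positivity) hβ⟩
        · exact Or.inl rfl
      · refine (Nat.sub_le _ _).trans (hcard.trans (Finset.card_le_card fun i hi => ?_))
        simp only [mem_filter, mem_univ, true_and]
        rw [hw i, if_pos hi]
        positivity
    · exact hbal
  have hw0 : ∀ i, 0 ≤ w i := fun i => by
    rcases hbal i with h | h
    · exact h.ge
    · exact ha.le.trans h.1
  have hsum : ∑ S ∈ powersetCard l (univ : Finset (Fin n)),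
      ((M.protocol n ρ thr).law x S t).toReal = κ * weightSum l w := by
    rw [weightSum, Finset.mul_sum]
    exact Finset.sum_congr rfl fun S _ => hz S
  rw [hsum] at hpos
  have hf : 0 < weightSum l w :=
    lt_of_le_of_ne (Finset.sum_nonneg fun _ _ => Finset.prod_nonneg fun _ _ => hw0 _)
      (right_ne_zero_of_mul hpos.ne').symm
  rw [Protocol.posterior_eq_marginal _ hln x t i (left_ne_zero_of_mul hpos.ne') hz]
  exact marginal_le_of_balanced ha hβ hbal hf hc hcard (by omega) hbl i

/-- Either all leakers survive for the secret, or few ignorant players do. -/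
theorem subset_survivors_or {x : 𝒳} {S : Finset (Fin n)} {t : List ℕ}
    (h : (M.protocol n ρ thr).law x S t ≠ 0) :
    S ⊆ M.survivors n x t ∨ #(M.survivors n x t \ S) + #S < thr := by
  refine Protocol.run_support_induction _ x _
    (fun t => S ⊆ M.survivors n x t ∨ #(M.survivors n x t \ S) + #S < thr)
    (fun t i m hI hnext hm => ?_) _ _ _ (Or.inl (by simp [survivors_nil])) h
  obtain ⟨-, hi⟩ := M.next_eq_some hnext
  have hmono : #(M.survivors n x (t ++ [m]) \ S) ≤ #(M.survivors n x t \ S) :=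
    Finset.card_le_card (Finset.sdiff_subset_sdiff (M.survivors_concat_subset x t m) le_rfl)
  rcases hI with hI | hI
  · by_cases hthr : thr ≤ #(M.survivors n x t)
    · left
      intro j hj
      rw [mem_survivors_concat]
      refine ⟨hI hj, fun hij hkill => hm ?_⟩
      have : i ∈ S := by rw [← hi, hij]; exact hj
      simp only [this, decide_true, if_true, protocol, hthr]
      exact M.leaking_of_mem x m hkill
    · right
      have := Finset.card_sdiff_add_card_eq_card hI
      omega
  · right; omega

end SieveMessages

/-- The expectation of `s` to the power of the indicator that a player, all of whose remaining `r`
messages are independent of the secret, survives. -/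
noncomputable def survivalMoment (N : ℕ) (s : ℝ) (r : ℕ) : ℝ :=
  1 - (N / (N + 1) : ℝ) ^ r + (N / (N + 1) : ℝ) ^ r * s

theorem survivalMoment_zero (s : ℝ) : survivalMoment N s 0 = s := by simp [survivalMoment]

/-- Conditioning on the next message: the player is eliminated with probability 1/(N+1), and then
contributes s^0 = 1. -/
theorem survivalMoment_succ (s : ℝ) (r : ℕ) :
    survivalMoment N s (r + 1) = 1 / (N + 1) + (1 - 1 / (N + 1)) * survivalMoment N s r := by
  have : (N : ℝ) + 1 ≠ 0 := by positivity
  rw [survivalMoment, survivalMoment, pow_succ]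
  field_simp
  ring

theorem survivalMoment_nonneg {s : ℝ} (hs : 0 ≤ s) (r : ℕ) : 0 ≤ survivalMoment N s r := by
  have h1 : (N / (N + 1) : ℝ) ^ r ≤ 1 :=
    pow_le_one₀ (by positivity) (by rw [div_le_one (by positivity)]; linarith)
  have h2 : 0 ≤ (N / (N + 1) : ℝ) ^ r * s := by positivity
  rw [survivalMoment]
  linarith

theorem survivalMoment_le_exp (s : ℝ) (r : ℕ) :
    survivalMoment N s r ≤ Real.exp ((N / (N + 1) : ℝ) ^ r * (s - 1)) := by
  refine le_trans (le_of_eq ?_) (Real.add_one_le_exp _)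
  rw [survivalMoment]
  ring

theorem tsum_mul_ite_eq (p : PMF ℕ) (K : Set ℕ) [DecidablePred (· ∈ K)] (A : ENNReal) {b : ℝ}
    (hb : 0 ≤ b) :
    ∑' m, p m * (A * if m ∈ K then 1 else ENNReal.ofReal b) =
      A * ENNReal.ofReal (prob p K + (1 - prob p K) * b) := by
  have e : ∀ m, p m * (A * if m ∈ K then 1 else ENNReal.ofReal b) =
      A * (K.indicator p m + Kᶜ.indicator p m * ENNReal.ofReal b) := by
    intro m
    by_cases hm : m ∈ K
    · simp [hm, mul_comm]
    · simp only [hm, if_false, not_false_eq_true, Set.indicator_of_notMem, zero_add,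
        Set.mem_compl_iff, Set.indicator_of_mem]
      ring
  simp_rw [e]
  rw [ENNReal.tsum_mul_left, ENNReal.tsum_add, ENNReal.tsum_mul_right,
    ← PMF.toOuterMeasure_apply, ← PMF.toOuterMeasure_apply]
  have hK : ∀ E : Set ℕ, p.toOuterMeasure E = ENNReal.ofReal (prob p E) := fun E =>
    (ENNReal.ofReal_toReal (toOuterMeasure_ne_top p E)).symm
  rw [hK, hK, prob_compl, ← ENNReal.ofReal_mul (by linarith [prob_le_one p K]),
    ← ENNReal.ofReal_add (prob_nonneg _ _)
      (mul_nonneg (by linarith [prob_le_one p K]) hb)]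

theorem prob_le_of_tsum_le {Ω : Type*} (p : PMF Ω) (Φ : Ω → ENNReal) {B v : ℝ} (hv : 0 < v)
    (hB : 0 ≤ B) (hΦ : ∑' t, p t * Φ t ≤ ENNReal.ofReal B) (E : Set Ω)
    (hE : ∀ t ∈ E, p t ≠ 0 → ENNReal.ofReal v ≤ Φ t) : prob p E ≤ B / v := by
  rw [le_div_iff₀ hv]
  have h : p.toOuterMeasure E * ENNReal.ofReal v ≤ ENNReal.ofReal B := by
    refine le_trans ?_ hΦ
    rw [PMF.toOuterMeasure_apply, ← ENNReal.tsum_mul_right]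
    refine ENNReal.tsum_le_tsum fun t => ?_
    by_cases ht : t ∈ E
    · by_cases h0 : p t = 0
      · simp [h0, ht]
      · simp only [ht, Set.indicator_of_mem]
        gcongr
        exact hE t ht h0
    · simp [ht]
  have h2 := ENNReal.toReal_mono ENNReal.ofReal_ne_top h
  rwa [ENNReal.toReal_mul, ENNReal.toReal_ofReal hv.le, ENNReal.toReal_ofReal hB] at h2

namespace SieveMessages

variable (M : SieveMessages 𝒳 N) {ρ thr : ℕ}

/-- Exponential moments of the number of survivors among players whose messages are independent
of the secret `y`. -/
theorem tsum_law_mul_le (x y : 𝒳) (S J : Finset (Fin n)) (hJ : x = y → Disjoint J S) {s : ℝ}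
    (hs : 0 ≤ s) :
    ∑' t, (M.protocol n ρ thr).law x S t * ENNReal.ofReal (s ^ #(M.survivors n y t ∩ J)) ≤
      ENNReal.ofReal (survivalMoment N s ρ ^ #J) := by
  classical
  -- The potential: each survivor in `J` contributes the moment for its remaining messages. It
  -- interpolates between the two sides of the claim.
  set Φ : List ℕ → ENNReal := fun t => ∏ i ∈ M.survivors n y t ∩ J,
    ENNReal.ofReal (survivalMoment N s (ρ - turns i t.length)) with hΦ
  have hstart : Φ [] = ENNReal.ofReal (survivalMoment N s ρ ^ #J) := by
    simp [hΦ, survivors_nil, turns, ENNReal.ofReal_pow (survivalMoment_nonneg hs ρ)]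
  have hend : ∀ t, (M.protocol n ρ thr).law x S t *
      ENNReal.ofReal (s ^ #(M.survivors n y t ∩ J)) = (M.protocol n ρ thr).law x S t * Φ t := by
    intro t
    by_cases h0 : (M.protocol n ρ thr).law x S t = 0
    · simp [h0]
    · congr 1
      have hlen := M.length_of_law_ne_zero h0
      simp [hΦ, hlen, turns_mul, survivalMoment_zero, ENNReal.ofReal_pow hs]
  simp_rw [hend]
  rw [← hstart]
  refine Protocol.tsum_run_mul_le _ x _ Φ (fun t i hnext => ?_) _ _
  obtain ⟨hlt, hi⟩ := M.next_eq_some hnext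
  set P : PMF ℕ := if decide (i ∈ S) = true then (M.protocol n ρ thr).leaking t x
    else (M.protocol n ρ thr).ignorant t with hP
  have hother : ∀ j, j ≠ i → turns j (t.length + 1) = turns j t.length := by
    intro j hj
    rw [turns_succ, hi, if_neg hj.symm, add_zero]
  by_cases hiJ : i ∈ M.survivors n y t ∩ J
  · obtain ⟨his, hij⟩ := mem_inter.mp hiJ
    set A : ENNReal := ∏ j ∈ (M.survivors n y t ∩ J).erase i,
      ENNReal.ofReal (survivalMoment N s (ρ - turns j t.length)) with hA
    have hturn : turns i (t.length + 1) = turns i t.length + 1 := by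
      rw [turns_succ, hi, if_pos rfl]
    have hρ : turns i t.length + 1 ≤ ρ := by
      rw [← hturn]
      exact (turns_mono i hlt).trans (turns_mul i ρ).le
    set r := ρ - turns i (t.length + 1) with hr
    have hr1 : ρ - turns i t.length = r + 1 := by omega
    -- A leaking sender in `J` has a secret other than `y` by `hJ`, so whether or not it still
    -- leaks, the kill probability is that of an ignorant player.
    have hprob : prob P (M.kill y) = 1 / (N + 1 : ℝ) := by
      rw [hP]
      by_cases hiS : i ∈ S
      · have hxy : x ≠ y := fun h => Finset.disjoint_left.mp (hJ h) hij hiS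
        simp only [hiS, decide_true, if_true, protocol]
        split
        · exact M.prob_leaking x y hxy
        · exact M.prob_ignorant y
      · simp only [hiS, decide_false, Bool.false_eq_true, if_false, protocol]
        exact M.prob_ignorant y
    have hΦt : Φ t = A * ENNReal.ofReal (survivalMoment N s (r + 1)) := by
      rw [hΦ, hA, ← hr1, mul_comm]
      exact (Finset.mul_prod_erase _ _ hiJ).symm
    have hΦm : ∀ m, Φ (t ++ [m]) =
        A * if m ∈ M.kill y then 1 else ENNReal.ofReal (survivalMoment N s r) := by
      intro m
      have hAm : A = ∏ j ∈ (M.survivors n y t ∩ J).erase i,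
          ENNReal.ofReal (survivalMoment N s (ρ - turns j (t ++ [m]).length)) := by
        refine Finset.prod_congr rfl fun j hj => ?_
        rw [List.length_append, List.length_singleton, hother j (Finset.ne_of_mem_erase hj)]
      rw [hAm]
      split
      · rename_i hm
        rw [mul_one, hΦ]
        refine Finset.prod_congr ?_ fun _ _ => rfl
        ext j
        simp only [mem_inter, mem_erase, mem_survivors_concat, hi]
        constructor
        · rintro ⟨⟨h1, h2⟩, h3⟩
          exact ⟨fun h => h2 h.symm hm, h1, h3⟩
        · rintro ⟨h1, h2, h3⟩
          exact ⟨⟨h2, fun h => absurd h.symm h1⟩, h3⟩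
      · rename_i hm
        have hset : M.survivors n y (t ++ [m]) = M.survivors n y t := by
          ext j
          simp [mem_survivors_concat, hm]
        simp only [hΦ, hset]
        rw [← Finset.mul_prod_erase _ _ hiJ, mul_comm, hr, List.length_append,
          List.length_singleton]
    simp_rw [hΦm]
    rw [tsum_mul_ite_eq P _ A (survivalMoment_nonneg hs r), hprob, hΦt, survivalMoment_succ]
  · have hΦm : ∀ m, Φ (t ++ [m]) = Φ t := by
      intro m
      rw [hΦ]
      refine Finset.prod_congr ?_ fun j hj => ?_
      · ext j
        simp only [mem_inter, mem_survivors_concat, hi]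
        constructor
        · rintro ⟨⟨h1, -⟩, h3⟩
          exact ⟨h1, h3⟩
        · rintro ⟨h1, h3⟩
          exact ⟨⟨h1, fun h => absurd (mem_inter.mpr ⟨h1, h3⟩) (h ▸ hiJ)⟩, h3⟩
      · rw [List.length_append, List.length_singleton, hother j]
        rintro rfl
        exact hiJ hj
    simp_rw [hΦm]
    rw [ENNReal.tsum_mul_right, PMF.tsum_coe, one_mul]

theorem prob_many_survivors_le {x y : 𝒳} (hxy : x ≠ y) (S : Finset (Fin n)) {s : ℝ} (hs : 1 ≤ s) :
    prob ((M.protocol n ρ thr).law x S) {t | thr ≤ #(M.survivors n y t)} ≤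
      survivalMoment N s ρ ^ n / s ^ thr := by
  have hs0 : 0 < s := by linarith
  have h := M.tsum_law_mul_le (ρ := ρ) (thr := thr) x y S univ (fun h => absurd h hxy) hs0.le
  rw [card_univ, Fintype.card_fin] at h
  refine prob_le_of_tsum_le _ _ (by positivity)
    (pow_nonneg (survivalMoment_nonneg hs0.le ρ) _) h _ fun t ht _ => ?_
  rw [inter_univ]
  exact ENNReal.ofReal_le_ofReal (pow_le_pow_right₀ hs ht)

theorem prob_few_survivors_le (x : 𝒳) (S : Finset (Fin n)) {s : ℝ} (hs0 : 0 < s) (hs : s ≤ 1) :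
    prob ((M.protocol n ρ thr).law x S) {t | #(M.survivors n x t \ S) + #S < thr} ≤
      survivalMoment N s ρ ^ (n - #S) / s ^ (thr - #S) := by
  classical
  have h := M.tsum_law_mul_le (ρ := ρ) (thr := thr) x x S Sᶜ (fun _ => disjoint_compl_left) hs0.le
  rw [card_compl, Fintype.card_fin] at h
  refine prob_le_of_tsum_le _ _ (by positivity)
    (pow_nonneg (survivalMoment_nonneg hs0.le ρ) _) h _ fun t ht _ => ?_
  refine ENNReal.ofReal_le_ofReal (pow_le_pow_of_le_one hs0.le hs ?_)
  have ht' : #(M.survivors n x t \ S) + #S < thr := ht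
  rw [Finset.sdiff_eq_inter_compl] at ht'
  omega

open Classical in
/-- Decode to a secret for which many players survive. -/
noncomputable def decode [Nonempty 𝒳] (n : ℕ) [NeZero n] (thr : ℕ) (t : List ℕ) : 𝒳 :=
  if h : ∃ x, thr ≤ #(M.survivors n x t) then h.choose else Classical.arbitrary 𝒳

theorem decode_eq [Nonempty 𝒳] {x : 𝒳} {t : List ℕ} (hx : thr ≤ #(M.survivors n x t))
    (hy : ∀ y, x ≠ y → #(M.survivors n y t) < thr) : M.decode n thr t = x := by
  have h : ∃ x, thr ≤ #(M.survivors n x t) := ⟨x, hx⟩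
  rw [decode, dif_pos h]
  by_contra hne
  exact absurd h.choose_spec (not_le.mpr (hy _ (Ne.symm hne)))

/-- Every possible transcript satisfies the posterior bound, so an error needs `thr` survivors for a
wrong secret (union bound, upper tail) or too few for the true one (lower tail among ignorant
players). -/
theorem isSafe [Fintype 𝒳] [Nonempty 𝒳] {c ε s s' : ℝ} {l : ℕ} (hln : l ≤ n) (hthr : thr ≤ n)
    (hthr1 : 1 < thr) (hN : 0 < N) (hc : 0 ≤ c)
    (hbl : (1 + 1 / (N : ℝ)) * l ≤ c * (thr - 1 : ℕ)) (hs : 1 ≤ s) (hs0' : 0 < s') (hs' : s' ≤ 1)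
    (hε : Fintype.card 𝒳 * (survivalMoment N s ρ ^ n / s ^ thr) +
      survivalMoment N s' ρ ^ (n - l) / s' ^ (thr - l) ≤ ε) :
    (M.protocol n ρ thr).IsSafe (M.decode n thr) (fixed l n hln) c ε := by
  classical
  have hpost := fun x t => M.posterior_le (ρ := ρ) hln hthr hthr1 hN hc hbl x t
  refine ⟨fun x => ?_, fun i t x ht => hpost x t ?_ i⟩
  swap
  · rw [Protocol.prob_transcript_secret] at ht
    exact pos_of_mul_pos_right ht (Protocol.prefactor_pos hln).le
  rw [Protocol.condProb_secret_fixed _ hln x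
    (fun t => (∀ i, (M.protocol n ρ thr).posterior (fixed l n hln) i t x ≤ c) ∧
      M.decode n thr t = x)]
  set G : Set (List ℕ) := {t | (∀ i, (M.protocol n ρ thr).posterior (fixed l n hln) i t x ≤ c) ∧
      M.decode n thr t = x} with hG
  have key : ∀ S ∈ powersetCard l (univ : Finset (Fin n)),
      1 - ε ≤ prob ((M.protocol n ρ thr).law x S) G := by
    intro S hS
    have hSl : #S = l := (mem_powersetCard.mp hS).2
    have hbad : prob ((M.protocol n ρ thr).law x S) Gᶜ ≤
        prob ((M.protocol n ρ thr).law x S) ((⋃ y ∈ univ.erase x,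
          {t | thr ≤ #(M.survivors n y t)}) ∪ {t | #(M.survivors n x t \ S) + #S < thr}) := by
      refine prob_mono_of_support _ fun t ht0 ht => ?_
      by_contra hcon
      simp only [Set.mem_union, Set.mem_iUnion, mem_erase, mem_univ, and_true, Set.mem_ofPred_eq,
        exists_prop, not_or, not_exists, not_and, not_le, not_lt] at hcon
      obtain ⟨h1, h2⟩ := hcon
      refine ht ⟨fun i => hpost x t ?_ i, M.decode_eq ?_ fun y hy => h1 y hy.symm⟩
      · exact Finset.sum_pos' (fun _ _ => ENNReal.toReal_nonneg)
          ⟨S, hS, ENNReal.toReal_pos ht0 (PMF.apply_ne_top _ _)⟩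
      · have hsub := (M.subset_survivors_or ht0).resolve_right (not_lt.mpr h2)
        rwa [Finset.card_sdiff_add_card_eq_card hsub] at h2
    have h3 := (prob_union_le _ _ _).trans (add_le_add
      ((prob_biUnion_le ((M.protocol n ρ thr).law x S) (univ.erase x)
        (fun y => {t | thr ≤ #(M.survivors n y t)})).trans
          (Finset.sum_le_sum fun y hy =>
            M.prob_many_survivors_le (Finset.ne_of_mem_erase hy).symm S hs))
      (M.prob_few_survivors_le (ρ := ρ) (thr := thr) x S hs0' hs'))
    rw [hSl, Finset.sum_const, nsmul_eq_mul] at h3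
    have h4 : ((#(univ.erase x) : ℕ) : ℝ) * (survivalMoment N s ρ ^ n / s ^ thr) ≤
        Fintype.card 𝒳 * (survivalMoment N s ρ ^ n / s ^ thr) := by
      refine mul_le_mul_of_nonneg_right ?_ (div_nonneg
        (pow_nonneg (survivalMoment_nonneg (by linarith) ρ) _) (by positivity))
      exact_mod_cast Finset.card_le_univ _
    rw [prob_compl] at hbad
    rw [hSl] at hbad
    linarith
  have hch : (0 : ℝ) < n.choose l := by exact_mod_cast Nat.choose_pos hln
  have hsum := Finset.sum_le_sum key
  rw [Finset.sum_const, card_powersetCard, card_univ, Fintype.card_fin, nsmul_eq_mul] at hsum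
  rw [inv_mul_eq_div, le_div_iff₀ hch]
  linarith

end SieveMessages

end Sieve

/-! ### Achievability: Chernoff exponents and choice of parameters. -/

/-- The Chernoff parameter 1/(1-c) is the threshold l/c over the approximate mean l(1-c)/c. The
exponents add to l(R log 2 + 1 + ζ) - l(R log 2 + 1 + 2ζ); the leading 2 comes from the ceiling. -/
theorem card_mul_upper_tail_le {c ζ R : ℝ} (hc : c ∈ Set.Ioo (0 : ℝ) 1) (hR : 0 < R)
    (hζ : R * Real.log 2 + 1 + 2 * ζ = -Real.log (1 - c) / c) {n l thr N ρ : ℕ}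
    (hn : n * (N / (N + 1) : ℝ) ^ ρ ≤ (1 + ζ) * (l * ((1 - c) / c))) (hthr : l / c ≤ thr) :
    ((2 ^ ⌈(l : ℝ) * R⌉₊ : ℕ) : ℝ) *
      (survivalMoment N (1 / (1 - c)) ρ ^ n / (1 / (1 - c)) ^ thr) ≤
        2 * Real.exp (-(l * ζ)) := by
  obtain ⟨hc0, hc1⟩ := hc
  have h1c : 0 < 1 - c := by linarith
  have hcard : ((2 ^ ⌈(l : ℝ) * R⌉₊ : ℕ) : ℝ) ≤ 2 * Real.exp (l * (R * Real.log 2)) := by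
    have hceil := Nat.ceil_lt_add_one (show 0 ≤ (l : ℝ) * R by positivity)
    push_cast
    rw [← Real.rpow_natCast]
    calc (2 : ℝ) ^ ((⌈(l : ℝ) * R⌉₊ : ℕ) : ℝ) ≤ 2 ^ ((l : ℝ) * R + 1) :=
          Real.rpow_le_rpow_of_exponent_le one_le_two hceil.le
      _ = 2 * Real.exp (l * (R * Real.log 2)) := by
          rw [Real.rpow_add two_pos, Real.rpow_one, Real.rpow_def_of_pos two_pos]
          ring_nf
  have hs : 0 ≤ 1 / (1 - c) := by positivity
  have hmom : survivalMoment N (1 / (1 - c)) ρ ^ n ≤ Real.exp ((1 + ζ) * l) := by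
    refine (pow_le_pow_left₀ (survivalMoment_nonneg hs ρ) (survivalMoment_le_exp _ ρ) n).trans ?_
    rw [← Real.exp_nat_mul]
    refine Real.exp_le_exp.mpr ?_
    have e : 1 / (1 - c) - 1 = c / (1 - c) := by field_simp; ring
    rw [e, ← mul_assoc]
    calc n * (N / (N + 1) : ℝ) ^ ρ * (c / (1 - c))
        ≤ (1 + ζ) * (l * ((1 - c) / c)) * (c / (1 - c)) := by gcongr
      _ = (1 + ζ) * l := by field_simp
  have hpow : ((1 / (1 - c)) ^ thr)⁻¹ ≤ Real.exp (l / c * Real.log (1 - c)) := by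
    have hlog : Real.log (1 - c) ≤ 0 := Real.log_nonpos h1c.le (by linarith)
    rw [one_div, inv_pow, inv_inv, ← Real.exp_log h1c, ← Real.exp_nat_mul, Real.exp_log h1c]
    exact Real.exp_le_exp.mpr (mul_le_mul_of_nonpos_right hthr hlog)
  calc ((2 ^ ⌈(l : ℝ) * R⌉₊ : ℕ) : ℝ) *
        (survivalMoment N (1 / (1 - c)) ρ ^ n / (1 / (1 - c)) ^ thr)
      ≤ 2 * Real.exp (l * (R * Real.log 2)) *
        (Real.exp ((1 + ζ) * l) * Real.exp (l / c * Real.log (1 - c))) := by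
        rw [div_eq_mul_inv]
        gcongr
        · exact mul_nonneg (pow_nonneg (survivalMoment_nonneg hs ρ) _) (by positivity)
    _ = 2 * Real.exp (-(l * ζ)) := by
        rw [mul_assoc, ← Real.exp_add, ← Real.exp_add]
        congr 2
        have : l / c * Real.log (1 - c) = -(l * (-Real.log (1 - c) / c)) := by ring
        rw [this, ← hζ]
        ring

theorem lower_tail_le {ζ A s : ℝ} (hs0 : 0 < s) (hs1 : s ≤ 1) {k j N ρ : ℕ}
    (hk : (1 + ζ / 2) * A ≤ k * (N / (N + 1) : ℝ) ^ ρ) (hj : j ≤ (1 + ζ / 4) * A) :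
    survivalMoment N s ρ ^ k / s ^ j ≤
      Real.exp (-(A * ((1 + ζ / 2) * (1 - s) + (1 + ζ / 4) * Real.log s))) := by
  have hmom : survivalMoment N s ρ ^ k ≤ Real.exp (-((1 + ζ / 2) * A * (1 - s))) := by
    refine (pow_le_pow_left₀ (survivalMoment_nonneg hs0.le ρ)
      (survivalMoment_le_exp _ ρ) k).trans ?_
    rw [← Real.exp_nat_mul]
    refine Real.exp_le_exp.mpr ?_
    have := mul_le_mul_of_nonneg_right hk (sub_nonneg.mpr hs1)
    linarith
  have hpow : (s ^ j)⁻¹ ≤ Real.exp (-((1 + ζ / 4) * A * Real.log s)) := by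
    have hlog : Real.log s ≤ 0 := Real.log_nonpos hs0.le hs1
    have e : s ^ j = Real.exp (j * Real.log s) := by rw [Real.exp_nat_mul, Real.exp_log hs0]
    rw [e, ← Real.exp_neg]
    refine Real.exp_le_exp.mpr (neg_le_neg ?_)
    exact mul_le_mul_of_nonpos_right hj hlog
  calc survivalMoment N s ρ ^ k / s ^ j
      ≤ Real.exp (-((1 + ζ / 2) * A * (1 - s))) *
        Real.exp (-((1 + ζ / 4) * A * Real.log s)) := by
        rw [div_eq_mul_inv]
        gcongr
    _ = _ := by
        rw [← Real.exp_add]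
        congr 1
        ring

theorem eventually_exp_bound {a b ε : ℝ} (ha : 0 < a) (hb : 0 < b) (hε : 0 < ε) :
    ∀ᶠ l : ℕ in Filter.atTop, 2 * Real.exp (-(l * a)) + Real.exp (-(l * b)) ≤ ε := by
  have h : ∀ a : ℝ, 0 < a →
      Filter.Tendsto (fun l : ℕ => Real.exp (-(l * a))) Filter.atTop (nhds 0) := fun a ha =>
    Real.tendsto_exp_neg_atTop_nhds_zero.comp (tendsto_natCast_atTop_atTop.atTop_mul_const ha)
  have h2 := ((h a ha).const_mul 2).add (h b hb)
  rw [mul_zero, add_zero] at h2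
  exact h2.eventually (Iic_mem_nhds hε)

theorem safelyAchievable_of_lt {c R : ℝ} (hc : c ∈ Set.Ioo (0 : ℝ) 1) (hR0 : 0 < R)
    (hR : R < -Real.logb 2 (1 - c) / c - Real.logb 2 (Real.exp 1)) : SafelyAchievable c R := by
  intro ε hε l₀
  obtain ⟨hc0, hc1⟩ := id hc
  have h1c : 0 < 1 - c := by linarith
  have hlog2 : 0 < Real.log 2 := Real.log_pos one_lt_two
  obtain ⟨ζ, hζ0, hζ⟩ : ∃ ζ : ℝ, 0 < ζ ∧
      R * Real.log 2 + 1 + 2 * ζ = -Real.log (1 - c) / c := by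
    refine ⟨(-Real.log (1 - c) / c - 1 - R * Real.log 2) / 2, ?_, by ring⟩
    rw [Real.logb, Real.logb, Real.log_exp] at hR
    have := mul_lt_mul_of_pos_right hR hlog2
    have e : (-(Real.log (1 - c) / Real.log 2) / c - 1 / Real.log 2) * Real.log 2 =
        -Real.log (1 - c) / c - 1 := by field_simp
    rw [e] at this
    linarith
  set ν : ℝ := (1 - c) / c with hν
  have hν0 : 0 < ν := by positivity
  -- A large N makes the imbalance 1 + 1/N cheap in the threshold. Then ρ makes the survival
  -- probability `a` so small that the l leakers hardly affect (n - l) * a.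
  obtain ⟨N, hN⟩ := exists_nat_gt (8 / (c * (ζ * ν)))
  have hN0 : (0 : ℝ) < N := lt_trans (by positivity) hN
  have hNpos : 0 < N := by exact_mod_cast hN0
  have hNinv : 1 / (N : ℝ) / c ≤ ζ * ν / 8 := by
    rw [div_lt_iff₀ (by positivity)] at hN
    rw [div_div, div_le_div_iff₀ (by positivity) (by positivity)]
    linarith
  have hα1 : (N / (N + 1) : ℝ) < 1 := by rw [div_lt_one (by positivity)]; linarith
  obtain ⟨ρ, hρ⟩ := exists_pow_lt_of_lt_one (show 0 < min (ζ * ν / 8) 1 by positivity) hα1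
  set a : ℝ := (N / (N + 1) : ℝ) ^ ρ with ha
  have ha0 : 0 < a := by positivity
  have ha1 : a < 1 := hρ.trans_le (min_le_right _ _)
  have haζ : a < ζ * ν / 8 := hρ.trans_le (min_le_left _ _)
  -- The optimal lower-tail parameter: cutoff over mean. Its exponent θ is positive because log(1/s)
  -- < 1/s - 1 strictly.
  set s : ℝ := (1 + ζ / 4) / (1 + ζ / 2) with hs
  have hs0 : 0 < s := by positivity
  have hs1 : s < 1 := by rw [hs, div_lt_one (by positivity)]; linarith
  set θ : ℝ := (1 + ζ / 2) * (1 - s) + (1 + ζ / 4) * Real.log s with hθ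
  have hθ0 : 0 < θ := by
    have hinv : s⁻¹ ≠ 1 := (one_lt_inv₀ hs0).mpr hs1 |>.ne'
    have h := Real.log_lt_sub_one_of_pos (inv_pos.mpr hs0) hinv
    rw [Real.log_inv] at h
    have h' := mul_lt_mul_of_pos_left h (show 0 < 1 + ζ / 4 by positivity)
    have e : (1 + ζ / 4) * (s⁻¹ - 1) = (1 + ζ / 2) * (1 - s) := by
      rw [hs]; field_simp
    rw [e] at h'
    linarith
  -- The requirement that l * (ζ * ν / 8) be at least 2 absorbs the rounding of n and k and the
  -- extra 1 in the threshold k + 1.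
  have hev := (eventually_exp_bound hζ0 (mul_pos hν0 hθ0) hε).and
    ((tendsto_natCast_atTop_atTop.atTop_mul_const
      (show 0 < ζ * ν / 8 by positivity)).eventually_ge_atTop 2)
  obtain ⟨l, ⟨hlε, hl2⟩, hl0, hlpos⟩ := (hev.and
    ((Filter.eventually_ge_atTop l₀).and (Filter.eventually_gt_atTop 0))).exists
  have hl : (0 : ℝ) < l := by exact_mod_cast hlpos
  set n : ℕ := ⌊(1 + ζ) * (l * ν) / a⌋₊ with hn
  set k : ℕ := ⌈(1 + 1 / (N : ℝ)) * l / c⌉₊ with hk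
  have hna : n * a ≤ (1 + ζ) * (l * ν) := by
    rw [← le_div_iff₀ ha0]
    exact Nat.floor_le (by positivity)
  have hna' : (1 + ζ) * (l * ν) - 1 ≤ n * a := by
    have := (Nat.lt_floor_add_one ((1 + ζ) * (l * ν) / a)).le
    rw [← hn, div_le_iff₀ ha0] at this
    linarith
  have hgap : (1 + ζ / 2) * (l * ν) ≤ (n - l) * a := by
    have := mul_le_mul_of_nonneg_left haζ.le hl.le
    linarith
  have hln' : (l : ℝ) < n := by
    have : 0 < ((n : ℝ) - l) * a := lt_of_lt_of_le (by positivity) hgap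
    linarith [pos_of_mul_pos_left this ha0.le]
  have hln : l < n := by exact_mod_cast hln'
  have hkle : (k : ℝ) + 1 - l ≤ (1 + ζ / 4) * (l * ν) := by
    have h1 := (Nat.ceil_lt_add_one
      (show 0 ≤ (1 + 1 / (N : ℝ)) * l / c by positivity)).le
    have h2 := mul_le_mul_of_nonneg_left hNinv hl.le
    have h3 : (1 + 1 / (N : ℝ)) * l / c = l + l * ν + l * (1 / (N : ℝ) / c) := by
      rw [hν]; field_simp; ring
    rw [← hk] at h1
    linarith
  have hkge : (1 + 1 / (N : ℝ)) * l / c ≤ k := Nat.le_ceil _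
  have hkl : (l : ℝ) / c ≤ k := by
    refine le_trans ?_ hkge
    gcongr
    exact le_mul_of_one_le_left hl.le (le_add_of_nonneg_right (by positivity))
  have hlk : (l : ℝ) ≤ k := le_trans (by rw [le_div_iff₀ hc0]; nlinarith) hkl
  have hthr : k + 1 ≤ n := by
    have h1 : ((n : ℝ) - l) * a ≤ n - l := by nlinarith
    have h2 : (1 + ζ / 4) * (l * ν) ≤ (1 + ζ / 2) * (l * ν) := by gcongr; norm_num
    have : ((k + 1 : ℕ) : ℝ) ≤ n := by push_cast; linarith
    exact_mod_cast this
  have hlk' : l ≤ k := by exact_mod_cast hlk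
  have : NeZero n := ⟨by omega⟩
  obtain ⟨M⟩ := nonempty_sieveMessages (Fin (2 ^ ⌈(l : ℝ) * R⌉₊)) hNpos
  refine ⟨l, hl0, n, hln.le, M.protocol n ρ (k + 1), M.decode n (k + 1),
    M.isSafe (s := 1 / (1 - c)) (s' := s) hln.le hthr (by omega) hNpos hc0.le ?_ ?_ hs0 hs1.le ?_⟩
  · rw [Nat.add_sub_cancel]
    rw [div_le_iff₀ hc0] at hkge
    linarith
  · rw [le_div_iff₀ h1c]; linarith
  · refine le_trans (add_le_add ?_ ?_) hlε
    · rw [Fintype.card_fin]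
      exact card_mul_upper_tail_le hc hR0 hζ hna (by push_cast; linarith)
    · have h := lower_tail_le (ζ := ζ) (A := l * ν) (k := n - l) (j := k + 1 - l) (N := N)
        (ρ := ρ) hs0 hs1.le (by rw [Nat.cast_sub hln.le]; exact hgap)
        (by rw [Nat.cast_sub (by omega)]; push_cast; exact hkle)
      rwa [← hθ, mul_assoc] at h

theorem SafelyAchievable.riskilyAchievable {c R : ℝ} (h : SafelyAchievable c R) :
    RiskilyAchievable c R := by
  intro ε hε l₀
  obtain ⟨l, hl, n, hln, π, D, hπ⟩ := h ε hε l₀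
  exact ⟨l, hl, n, hln, π, D, hπ.1⟩

theorem capacity_pos {c : ℝ} (hc : c ∈ Set.Ioo (0 : ℝ) 1) :
    0 < -Real.logb 2 (1 - c) / c - Real.logb 2 (Real.exp 1) := by
  obtain ⟨hc0, hc1⟩ := hc
  have hlog2 : 0 < Real.log 2 := Real.log_pos one_lt_two
  have h := Real.log_lt_sub_one_of_pos (show 0 < 1 - c by linarith) (by linarith)
  rw [Real.logb, Real.logb, Real.log_exp, sub_pos, lt_div_iff₀ hc0, ← neg_div,
    div_mul_eq_mul_div, div_lt_div_iff_of_pos_right hlog2]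
  linarith

/-- As the capacity is positive, achievability is needed for positive rates only. -/
theorem isLUB_of_forall_pos_lt {s : Set ℝ} {C : ℝ} (hC : 0 < C) (hs : ∀ R ∈ s, R ≤ C)
    (h : ∀ R, 0 < R → R < C → R ∈ s) : IsLUB s C := by
  refine ⟨hs, fun B hB => ?_⟩
  by_contra! hlt
  have h1 : max B 0 < C := max_lt hlt hC
  have h2 := hB (h ((max B 0 + C) / 2) (by linarith [le_max_right B 0]) (by linarith))
  linarith [le_max_left B 0]

end Cryptogenography

theorem mainTheorem1 (c : ℝ) (hc : c ∈ Set.Ioo (0 : ℝ) 1) :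
    Cryptogenography.IsSafeCapacity c
        (-Real.logb 2 (1 - c) / c - Real.logb 2 (Real.exp 1)) ∧
      Cryptogenography.IsRiskyCapacity c
        (-Real.logb 2 (1 - c) / c - Real.logb 2 (Real.exp 1)) := by
  constructor
  · exact Cryptogenography.isLUB_of_forall_pos_lt (Cryptogenography.capacity_pos hc)
      (fun R hR => Cryptogenography.RiskilyAchievable.le hc hR.riskilyAchievable)
      fun R hR0 hR => Cryptogenography.safelyAchievable_of_lt hc hR0 hR
  · exact Cryptogenography.isLUB_of_forall_pos_lt (Cryptogenography.capacity_pos hc)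
      (fun R hR => Cryptogenography.RiskilyAchievable.le hc hR)
      fun R hR0 hR => (Cryptogenography.safelyAchievable_of_lt hc hR0 hR).riskilyAchievable
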